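/- Let $(X,\mu)$ be an atom-free standard probability space with a fixed isomorphism mod $0$, $\sigma:[0,1]\to X$, from Lebesgue measure on $[0,1]$ to $(X,\mu)$. Let $w:X\times X\to[0,1]$ be a graphon (measurable, and $w(x,y)=w(y,x)$ almost everywhere), let $(T_w\xi)(x)=\int_X w(x,y)\xi(y)\,d\mu(y)$ be its integral operator on $L^2(X)=L^2(X,\mu;\mathbb C)$, and let $f\in L^2(X)$. For a real number $c$ let $\widehat f(c)$ be the orthogonal projection of $f$ onto $\ker(T_w-c)$; thus $\widehat f(0)=P_0^w(f)$ is its projection onto the null space of $T_w$, and, for nonzero eigenvalues $c$, $\widehat f(c)$ is the graphon Fourier transform of $f$ at $c$. For a compact self-adjoint operator $T$ list its nonzero eigenvalues, repeated according to multiplicity, as $$\lambda_1(T)\ge\lambda_2(T)\ge\dots\ge 0\ge\dots\ge\lambda_{-2}(T)\ge\lambda_{-1}(T),$$ where the positive and the negative part are padded with zeros if they are finite. For a nonzero eigenvalue $c$ of $T_w$ put $I_c=\{i\in\mathbb Z\setminus\{0\}:\lambda_i(T_w)=c\}$, a finite set. For each $n\in\mathbb N$ let $G_n$ be a (simple) graph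 with vertices labelled $1,\dots,N_n$ and adjacency matrix $A_n$, and let $f_n\in\mathbb C^{N_n}$ be a signal on $G_n$. Split $[0,1]$ into the intervals $J^n_k=[\frac{k-1}{N_n},\frac{k}{N_n})$, $1\le k\le N_n$. For $g\in\mathbb C^{N_n}$ let $g^X\in L^2(X)$ be the function with value $\sqrt{N_n}\,g(k)$ on $\sigma(J^n_k)$, and let $w_{G_n,X}$ be the graphon on $X$ that is $1$ on $\sigma(J^n_k)\times\sigma(J^n_l)$ if $k$ and $l$ are adjacent in $G_n$, and $0$ otherwise. Suppose that, with these labellings, $(w_{G_n,X},f_n^X)$ converges in norm to $(w,f)$, that is, $$\sup_{S,T\subseteq X\text{ measurable}}\Big|\int_{S\times T}(w_{G_n,X}-w)\,d(\mu\times\mu)\Big|\to0\quad\text{and}\quad\|f_n^X-f\|_2\to0 .$$ For each $n$ let $\phi^n_i$, for the indices $i$ with $\lambda_i(A_n)\ne0$, be orthonormal vectors in $\mathbb C^{N_n}$ with $A_n\phi_i^n=\lambda_i(A_n)\phi_i^n$, and let $\widehat{f_n}(\phi^n_i)=\sum_v f_n(v)\overline{\phi^n_i(v)}$. Terms with $\lambda_i(A_n)=0$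 are omitted from the sums over $i$ below. Then for each nonzero eigenvalue $c$ of $T_w$, $$\sum_{i\in I_c}\widehat{f_n}(\phi^n_i)\,(\phi^n_i)^X\longrightarrow\widehat f(c)\quad\text{in }L^2(X)\text{ as }n\to\infty .$$ Moreover, if $P_0^w(f)=0$, then the following sum over all distinct nonzero eigenvalues $c$ of $T_w$ is finite for every $n$, and $$\sum_{c}\Big\|\sum_{i\in I_c}\widehat{f_n}(\phi^n_i)\,(\phi^n_i)^X-\widehat f(c)\Big\|_2^2\longrightarrow0\quad\text{as }n\to\infty .$$ -/

import Mathlib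

open MeasureTheory Filter Topology
open scoped ENNReal

namespace GraphonSignal

/-! ### Ordered eigenvalues and eigenprojections -/

section Spectral

variable {H : Type*} [NormedAddCommGroup H] [InnerProductSpace ℂ H]

/-- The number of eigenvalues of `T` in `[t, ∞)`, counted with multiplicity: the dimension of the
span of the eigenspaces of `T` for the real numbers `s ≥ t`. -/
noncomputable def eigenCount (T : Module.End ℂ H) (t : ℝ) : ℕ :=
  Module.finrank ℂ
    (⨆ s : {s : ℝ // t ≤ s}, Module.End.eigenspace T ((s : ℝ) : ℂ) : Submodule ℂ H)

/-- For `k ≥ 1`, the `k`-th largest positive eigenvalue of `T` (counted with multiplicity),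
and `0` if `T` has fewer than `k` positive eigenvalues (then the set below is empty). -/
noncomputable def posEigenvalue (T : Module.End ℂ H) (k : ℕ) : ℝ :=
  sSup {t : ℝ | 0 < t ∧ k ≤ eigenCount T t}

/-- The ordering `λ₁ ≥ λ₂ ≥ … ≥ 0 ≥ … ≥ λ₋₂ ≥ λ₋₁` of the nonzero eigenvalues of a compact
self-adjoint operator, indexed by the nonzero integers, repeated according to multiplicity and
padded with zeros. The index `0` is not used, and gets the value `0`. -/
noncomputable def orderedEigenvalue (T : Module.End ℂ H) (i : ℤ) : ℝ :=
  if 0 < i then posEigenvalue T i.natAbs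
  else if i < 0 then -posEigenvalue (-T) i.natAbs
  else 0

/-- The set of indices that enumerate the nonzero eigenvalues of `T`. -/
def indexSet (T : Module.End ℂ H) : Set ℤ := {i | orderedEigenvalue T i ≠ 0}

/-- For a nonzero eigenvalue `c` of `T`, the set of indices `i` such that `λᵢ(T) = c`. -/
def eigenIndices (T : Module.End ℂ H) (c : ℝ) : Set ℤ :=
  {i | i ∈ indexSet T ∧ orderedEigenvalue T i = c}

/-- `φ` lists orthonormal eigenvectors of `T` for its nonzero eigenvalues in their given order.
The values of `φ` outside `indexSet T` are irrelevant. -/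
structure IsOrderedEigenbasis (T : Module.End ℂ H) (φ : ℤ → H) : Prop where
  eigen : ∀ i ∈ indexSet T, T (φ i) = ((orderedEigenvalue T i : ℝ) : ℂ) • φ i
  orthonormal : Orthonormal ℂ (fun i : indexSet T => φ i)

theorem isClosed_eigenspace (T : H →L[ℂ] H) (c : ℂ) :
    IsClosed (Module.End.eigenspace (T : Module.End ℂ H) c : Set H) := by
  have h : (Module.End.eigenspace (T : Module.End ℂ H) c : Set H) = {x | T x = c • x} := by
    ext x
    simp
  rw [h]
  exact isClosed_eq T.continuous (continuous_const_smul c)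

variable [CompleteSpace H]

instance completeSpace_eigenspace (T : H →L[ℂ] H) (c : ℂ) :
    CompleteSpace (Module.End.eigenspace (T : Module.End ℂ H) c) :=
  (isClosed_eigenspace T c).completeSpace_coe

/-- The orthogonal projection onto the `c`-eigenspace of `T`; for `c = 0`, onto the null space. -/
noncomputable def eigenProj (T : H →L[ℂ] H) (c : ℝ) : H →L[ℂ] H :=
  (Module.End.eigenspace (T : Module.End ℂ H) (c : ℂ)).starProjection

end Spectral

/-! ### Graphons and their integral operators -/

section Graphon

variable {X : Type*} [MeasurableSpace X]

/-- A graphon represented on `(X, μ)`: a measurable map `X × X → [0,1]`, symmetric almost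
everywhere. Measurability is up to null sets, so that it does not matter whether the σ-algebras
are completed. -/
structure Graphon (μ : Measure X) where
  toFun : X → X → ℝ
  aemeasurable' : AEMeasurable (fun p : X × X => toFun p.1 p.2) (μ.prod μ)
  nonneg' : ∀ x y, 0 ≤ toFun x y
  le_one' : ∀ x y, toFun x y ≤ 1
  symm' : ∀ᵐ p : X × X ∂(μ.prod μ), toFun p.1 p.2 = toFun p.2 p.1

/-- The cut norm `sup_{S,T} |∫_{S × T} u|`, over measurable `S, T ⊆ X`. -/
noncomputable def cutNorm (μ : Measure X) (u : X → X → ℝ) : ℝ :=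
  sSup {r : ℝ | ∃ S T : Set X, MeasurableSet S ∧ MeasurableSet T ∧
    r = |∫ p in S ×ˢ T, u p.1 p.2 ∂(μ.prod μ)|}

/-- Convergence in norm of a sequence of graphon signals: the kernels converge in cut norm and the
signals in `L²`. -/
def ConvergesInNorm {μ : Measure X} (w' : ℕ → Graphon μ) (f' : ℕ → Lp ℂ 2 μ)
    (w : Graphon μ) (f : Lp ℂ 2 μ) : Prop :=
  Tendsto (fun n => cutNorm μ (fun x y => (w' n).toFun x y - w.toFun x y)) atTop (𝓝 0) ∧
  Tendsto (fun n => ‖f' n - f‖) atTop (𝓝 0)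

variable {μ : Measure X} [IsProbabilityMeasure μ]

/-- The function `x ↦ ∫ w(x,y) ξ(y) dμ(y)`. -/
noncomputable def Graphon.opFun (w : Graphon μ) (ξ : X → ℂ) (x : X) : ℂ :=
  ∫ y, (w.toFun x y : ℂ) * ξ y ∂μ

theorem Graphon.norm_opFun_le (w : Graphon μ) (ξ : Lp ℂ 2 μ) (x : X) :
    ‖w.opFun ξ x‖ ≤ ‖ξ‖ := by
  have hint : Integrable (ξ : X → ℂ) μ := (Lp.memLp ξ).integrable (by norm_num)
  have h1 : ‖w.opFun ξ x‖ ≤ ∫ y, ‖ξ y‖ ∂μ := by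
    refine norm_integral_le_of_norm_le hint.norm (Eventually.of_forall fun y => ?_)
    rw [norm_mul, Complex.norm_real, Real.norm_of_nonneg (w.nonneg' x y)]
    exact mul_le_of_le_one_left (norm_nonneg _) (w.le_one' x y)
  refine h1.trans ?_
  rw [integral_norm_eq_lintegral_enorm hint.aestronglyMeasurable, ← eLpNorm_one_eq_lintegral_enorm,
    Lp.norm_def]
  exact ENNReal.toReal_mono (Lp.eLpNorm_ne_top ξ)
    (eLpNorm_le_eLpNorm_of_exponent_le (by norm_num) hint.aestronglyMeasurable)

theorem Graphon.aestronglyMeasurable_kernel {ν : Measure X} (w : Graphon ν) :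
    AEStronglyMeasurable (fun p : X × X => (w.toFun p.1 p.2 : ℂ)) (ν.prod ν) :=
  (Complex.measurable_ofReal.comp_aemeasurable w.aemeasurable').aestronglyMeasurable

theorem Graphon.memLp_opFun (w : Graphon μ) (ξ : Lp ℂ 2 μ) : MemLp (w.opFun ξ) 2 μ := by
  refine MemLp.of_bound ?_ ‖ξ‖ (Eventually.of_forall (w.norm_opFun_le ξ))
  exact AEStronglyMeasurable.integral_prod_right' (f := fun p : X × X =>
    (w.toFun p.1 p.2 : ℂ) * ξ p.2)
    (w.aestronglyMeasurable_kernel.mul (Lp.aestronglyMeasurable ξ).comp_snd)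

theorem Graphon.ae_integrable (w : Graphon μ) (ξ : Lp ℂ 2 μ) :
    ∀ᵐ x ∂μ, Integrable (fun y => (w.toFun x y : ℂ) * ξ y) μ := by
  have hint : Integrable (ξ : X → ℂ) μ := (Lp.memLp ξ).integrable (by norm_num)
  filter_upwards [w.aestronglyMeasurable_kernel.prodMk_left] with x hx
  refine hint.bdd_mul (c := 1) hx (Eventually.of_forall fun y => ?_)
  rw [Complex.norm_real, Real.norm_of_nonneg (w.nonneg' x y)]
  exact w.le_one' x y

/-- The integral operator `T_w` on `L²(X)`, `(T_w ξ)(x) = ∫ w(x,y) ξ(y) dμ(y)`. -/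
noncomputable def Graphon.op (w : Graphon μ) : Lp ℂ 2 μ →L[ℂ] Lp ℂ 2 μ :=
  LinearMap.mkContinuous
    { toFun := fun ξ => (w.memLp_opFun ξ).toLp _
      map_add' := by
        intro ξ η
        rw [← MemLp.toLp_add, MemLp.toLp_eq_toLp_iff]
        filter_upwards [w.ae_integrable ξ, w.ae_integrable η] with x h1 h2
        rw [Pi.add_apply]
        unfold Graphon.opFun
        rw [← integral_add h1 h2]
        refine integral_congr_ae ?_
        filter_upwards [Lp.coeFn_add ξ η] with y hy
        rw [hy, Pi.add_apply, mul_add]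
      map_smul' := by
        intro c ξ
        rw [RingHom.id_apply, ← MemLp.toLp_const_smul, MemLp.toLp_eq_toLp_iff]
        refine Eventually.of_forall fun x => ?_
        rw [Pi.smul_apply]
        unfold Graphon.opFun
        rw [← integral_smul]
        refine integral_congr_ae ?_
        filter_upwards [Lp.coeFn_smul c ξ] with y hy
        rw [hy, Pi.smul_apply, smul_eq_mul, smul_eq_mul]
        ring }
    1 (by
      intro ξ
      have h := Lp.norm_le_of_ae_bound (f := (w.memLp_opFun ξ).toLp _) (norm_nonneg ξ) (by
        filter_upwards [(w.memLp_opFun ξ).coeFn_toLp] with x hx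
        rw [hx]
        exact w.norm_opFun_le ξ x)
      simpa [measureUnivNNReal] using h)

/-- The graphon Fourier transform: `f̂(c)` is the orthogonal projection of `f` onto the
`c`-eigenspace of `T_w`. In particular `f̂(0)` is the projection onto the null space of `T_w`. -/
noncomputable def graphonFourier (w : Graphon μ) (f : Lp ℂ 2 μ) (c : ℝ) : Lp ℂ 2 μ :=
  eigenProj w.op c f

end Graphon

/-! ### Graph signals, and their representation on a probability space -/

section Representation

variable {X : Type*} [MeasurableSpace X]

/-- An isomorphism mod 0 between `[0,1]` with Lebesgue measure and `(X, μ)`: measure-preserving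
maps in both directions that are inverse to each other almost everywhere. A probability space for
which there is one is, up to completion, exactly an atom-free standard probability space.
Null measurability is used in order to allow completed σ-algebras. -/
structure IsoModZero (μ : Measure X) where
  toFun : unitInterval → X
  invFun : X → unitInterval
  nullMeasurable_toFun : NullMeasurable toFun volume
  nullMeasurable_invFun : NullMeasurable invFun μ
  measure_preimage_toFun : ∀ s : Set X, MeasurableSet s → volume (toFun ⁻¹' s) = μ s
  measure_preimage_invFun : ∀ s : Set unitInterval, MeasurableSet s → μ (invFun ⁻¹' s) = volume s
  left_inv : ∀ᵐ t : unitInterval, invFun (toFun t) = t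
  right_inv : ∀ᵐ x ∂μ, toFun (invFun x) = x

/-- The `k`-th of `N` intervals of equal length in `[0,1]` (counted from `0`). -/
def interval (N : ℕ) (k : Fin N) : Set unitInterval :=
  {t | (k : ℝ) / N ≤ t ∧ (t : ℝ) < ((k : ℝ) + 1) / N}

theorem measurableSet_interval (N : ℕ) (k : Fin N) : MeasurableSet (interval N k) :=
  (measurableSet_le measurable_const measurable_subtype_coe).inter
    (measurableSet_lt measurable_subtype_coe measurable_const)

open Classical in
/-- The `0/1`-valued kernel on `[0,1]` of a labelled graph on `N` vertices. -/
noncomputable def graphKernel {N : ℕ} (G : SimpleGraph (Fin N)) (s t : unitInterval) : ℝ :=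
  if ∃ k l : Fin N, G.Adj k l ∧ s ∈ interval N k ∧ t ∈ interval N l then 1 else 0

theorem measurable_graphKernel {N : ℕ} (G : SimpleGraph (Fin N)) :
    Measurable (fun p : unitInterval × unitInterval => graphKernel G p.1 p.2) := by
  classical
  refine Measurable.ite ?_ measurable_const measurable_const
  have h : {p : unitInterval × unitInterval |
      ∃ k l : Fin N, G.Adj k l ∧ p.1 ∈ interval N k ∧ p.2 ∈ interval N l} =
      ⋃ k : Fin N, ⋃ l : Fin N, ⋃ _ : G.Adj k l, interval N k ×ˢ interval N l := by
    ext p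
    simp only [Set.mem_ofPred_eq, Set.mem_iUnion, Set.mem_prod, exists_prop]
  rw [h]
  exact MeasurableSet.iUnion fun k => MeasurableSet.iUnion fun l => MeasurableSet.iUnion fun _ =>
    (measurableSet_interval N k).prod (measurableSet_interval N l)

theorem graphKernel_symm {N : ℕ} (G : SimpleGraph (Fin N)) (s t : unitInterval) :
    graphKernel G s t = graphKernel G t s := by
  unfold graphKernel
  congr 1
  exact propext ⟨fun ⟨k, l, h, hs, ht⟩ => ⟨l, k, h.symm, ht, hs⟩,
    fun ⟨k, l, h, hs, ht⟩ => ⟨l, k, h.symm, ht, hs⟩⟩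

variable {μ : Measure X} [IsProbabilityMeasure μ]

/-- The graphon `w_{G,X}` of a labelled graph `G`, represented on `X`:
`w_{G,X}(x,y) = w_G(σ⁻¹ x, σ⁻¹ y)`. -/
noncomputable def graphGraphon (σ : IsoModZero μ) {N : ℕ} (G : SimpleGraph (Fin N)) :
    Graphon μ where
  toFun x y := graphKernel G (σ.invFun x) (σ.invFun y)
  aemeasurable' := by
    have h := σ.nullMeasurable_invFun.aemeasurable
    exact (measurable_graphKernel G).comp_aemeasurable (h.comp_fst.prodMk h.comp_snd)
  nonneg' x y := by unfold graphKernel; split_ifs <;> norm_num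
  le_one' x y := by unfold graphKernel; split_ifs <;> norm_num
  symm' := Eventually.of_forall fun _ => graphKernel_symm G _ _

open Classical in
/-- The function `f^X`, equal to `√N f(k)` on `σ(I_k)`. -/
noncomputable def signalFun (σ : IsoModZero μ) {N : ℕ} (f : EuclideanSpace ℂ (Fin N)) (x : X) :
    ℂ :=
  ∑ k : Fin N, if σ.invFun x ∈ interval N k then (Real.sqrt N : ℂ) * f k else 0

theorem memLp_signalFun (σ : IsoModZero μ) {N : ℕ} (f : EuclideanSpace ℂ (Fin N)) :
    MemLp (signalFun σ f) 2 μ := by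
  classical
  refine memLp_finsetSum _ fun k _ => ?_
  have hm : AEStronglyMeasurable
      (fun x => if σ.invFun x ∈ interval N k then (Real.sqrt N : ℂ) * f k else 0) μ := by
    have h : Measurable (fun t : unitInterval =>
        if t ∈ interval N k then (Real.sqrt N : ℂ) * f k else 0) :=
      Measurable.ite (measurableSet_interval N k) measurable_const measurable_const
    exact (h.comp_aemeasurable σ.nullMeasurable_invFun.aemeasurable).aestronglyMeasurable
  refine MemLp.of_bound hm ‖(Real.sqrt N : ℂ) * f k‖ (Eventually.of_forall fun x => ?_)
  split_ifs
  · exact le_rfl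
  · rw [norm_zero]
    exact norm_nonneg _

/-- The element `f^X` of `L²(X)` that represents the graph signal `f`. -/
noncomputable def signalLp (σ : IsoModZero μ) {N : ℕ} (f : EuclideanSpace ℂ (Fin N)) :
    Lp ℂ 2 μ :=
  (memLp_signalFun σ f).toLp _

open Classical in
/-- The adjacency matrix of `G` as an operator on `ℂ^N`. -/
noncomputable def adjOp {N : ℕ} (G : SimpleGraph (Fin N)) :
    Module.End ℂ (EuclideanSpace ℂ (Fin N)) :=
  Matrix.toEuclideanLin (G.adjMatrix ℂ)

/-- The graph Fourier coefficient `f̂(φ) = ∑ᵥ f(v) conj(φ(v))`. -/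
noncomputable def graphFourier {N : ℕ} (f φ : EuclideanSpace ℂ (Fin N)) : ℂ :=
  ∑ v, f v * (starRingEnd ℂ) (φ v)

/-- `∑_{i ∈ I} f̂(φᵢ) φᵢ^X`, where only those indices in `I` contribute that enumerate a nonzero
eigenvalue of the adjacency matrix; there are finitely many of these. -/
noncomputable def recombine (σ : IsoModZero μ) {N : ℕ} (G : SimpleGraph (Fin N))
    (φ : ℤ → EuclideanSpace ℂ (Fin N)) (f : EuclideanSpace ℂ (Fin N)) (I : Set ℤ) : Lp ℂ 2 μ :=
  ∑ᶠ i ∈ I ∩ indexSet (adjOp G), graphFourier f (φ i) • signalLp σ (φ i)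

end Representation

end GraphonSignal

namespace GraphonSignal

/-! ### Spectral decomposition of compact self-adjoint operators -/

section CompactSelfAdjoint

variable {H : Type*} [NormedAddCommGroup H] [InnerProductSpace ℂ H]

/-! The kernels $u = w_{G_n,X}-w$ are bounded by $1$. Truncating $L^2$ functions at height
$M\|\xi\|$ therefore bounds $\|T_u\|$ by $16M^2\|u\|_\square + 2/M$, so cut-norm convergence gives
convergence of the integral operators in operator norm (`Graphon.norm_op_sub_op_le`). Operators of
graphs have finite rank, hence $T_w$ is compact. The map $g\mapsto g^X$ is an isometry that carries
$A_n/N_n$ to the operator of $w_{G_n,X}$, which has no nonzero eigenvectors outside its range. So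
both have the same index set, and $(\phi^n_i)^X$ is an ordered eigenbasis. What remains is
perturbation theory for compact self-adjoint operators $T_n\to T$.

For $c\ne0$, Weyl's inequality and the isolation of $c$ in the spectrum show that $I_c$ has
$\dim\ker(T-c)$ elements and that $\lambda_i(T_n)\to c$ for $i\in I_c$
(`exists_finset_eigenIndices`). The eigenvectors with these indices are approximate eigenvectors of
$T$ at $c$; the spectral gap makes them approach $\ker(T-c)$ (`mul_norm_sub_eigenProj_le`). As there
are exactly as many of them as the dimension, the projections onto their spans converge strongly
(`tendsto_sum_inner_smul`). This is the first claim.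

For the second claim, Bessel bounds the total mass of the $n$-th family by $\|f_n^X\|^2\to\|f\|^2$.
If $P_0^wf=0$, then $\|f\|^2$ is exactly the mass of the limit family, so no mass can escape to the
tail, and termwise convergence improves to convergence in $\ell^2$ (`tendsto_tsum_norm_sub_sq`). -/

/-- The span of the eigenspaces of `T` for the real numbers `s ≥ t`. -/
def eigenSpan (T : Module.End ℂ H) (t : ℝ) : Submodule ℂ H :=
  ⨆ s : {s : ℝ // t ≤ s}, Module.End.eigenspace T ((s : ℝ) : ℂ)

theorem eigenspace_le_eigenSpan (T : Module.End ℂ H) {s t : ℝ} (h : t ≤ s) :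
    Module.End.eigenspace T (s : ℂ) ≤ eigenSpan T t :=
  le_iSup (fun s : {s : ℝ // t ≤ s} => Module.End.eigenspace T ((s : ℝ) : ℂ)) ⟨s, h⟩

theorem eigenSpan_le_iff {T : Module.End ℂ H} {t : ℝ} {K : Submodule ℂ H} :
    eigenSpan T t ≤ K ↔ ∀ s : ℝ, t ≤ s → Module.End.eigenspace T (s : ℂ) ≤ K :=
  iSup_le_iff.trans ⟨fun h s hs => h ⟨s, hs⟩, fun h s => h s s.2⟩

theorem eigenSpan_antitone (T : Module.End ℂ H) : Antitone (eigenSpan T) := fun _ _ h =>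
  eigenSpan_le_iff.2 fun _ hs => eigenspace_le_eigenSpan T (h.trans hs)

theorem isOrtho_eigenspace {T : Module.End ℂ H} (hs : LinearMap.IsSymmetric T) {a b : ℝ}
    (h : a ≠ b) : Module.End.eigenspace T (a : ℂ) ⟂ Module.End.eigenspace T (b : ℂ) :=
  hs.orthogonalFamily_eigenspaces.isOrtho (Complex.ofReal_injective.ne h)

theorem isOrtho_eigenspace_eigenSpan {T : Module.End ℂ H} (hs : LinearMap.IsSymmetric T) {a t : ℝ}
    (h : a < t) : Module.End.eigenspace T (a : ℂ) ⟂ eigenSpan T t := by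
  rw [eigenSpan, Submodule.isOrtho_iSup_right]
  exact fun s => isOrtho_eigenspace hs (h.trans_le s.2).ne

theorem eigenspace_neg (T : Module.End ℂ H) (c : ℂ) :
    Module.End.eigenspace (-T) c = Module.End.eigenspace T (-c) := by
  ext x
  rw [Module.End.mem_eigenspace_iff, Module.End.mem_eigenspace_iff, LinearMap.neg_apply, neg_smul,
    neg_eq_iff_eq_neg]

theorem eigenspace_eq_bot_of_norm_lt (T : H →L[ℂ] H) {c : ℂ} (h : ‖T‖ < ‖c‖) :
    Module.End.eigenspace (T : Module.End ℂ H) c = ⊥ := by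
  rw [Submodule.eq_bot_iff]
  intro x hx
  rw [Module.End.mem_eigenspace_iff] at hx
  by_contra hne
  have h1 : ‖c‖ * ‖x‖ ≤ ‖T‖ * ‖x‖ := by
    rw [← norm_smul, ← hx]
    exact T.le_opNorm x
  exact absurd (le_of_mul_le_mul_right h1 (norm_pos_iff.2 hne)) (not_le.2 h)

/-- Eigenvalues of a symmetric operator are real, so indexing eigenprojections by `ℝ` loses nothing.
-/
theorem iSup_eigenspace_ofReal {T : H →L[ℂ] H} (hs : (T : H →ₗ[ℂ] H).IsSymmetric) :
    ⨆ c : ℝ, Module.End.eigenspace (T : Module.End ℂ H) (c : ℂ) =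
      ⨆ c : ℂ, Module.End.eigenspace (T : Module.End ℂ H) c := by
  refine le_antisymm (iSup_le fun c => le_iSup (Module.End.eigenspace (T : Module.End ℂ H)) (c : ℂ))
    (iSup_le fun z => ?_)
  by_cases hz : Module.End.HasEigenvalue (T : Module.End ℂ H) z
  · obtain ⟨r, rfl⟩ := Complex.conj_eq_iff_real.1 (hs.conj_eigenvalue_eq_self hz)
    exact le_iSup (fun c : ℝ => Module.End.eigenspace (T : Module.End ℂ H) (c : ℂ)) r
  · rw [Module.End.hasEigenvalue_iff, not_not] at hz
    rw [hz]
    exact bot_le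

theorem eigenCount_eq_finrank (T : Module.End ℂ H) (t : ℝ) :
    eigenCount T t = Module.finrank ℂ (eigenSpan T t) := rfl

/-- The orthogonal projection from `V` to `W` has a kernel by dimension count. This supplies the
test vector in the min-max argument. -/
theorem exists_mem_orthogonal_of_finrank_lt {V W : Submodule ℂ H} [FiniteDimensional ℂ V]
    [FiniteDimensional ℂ W] (h : Module.finrank ℂ W < Module.finrank ℂ V) :
    ∃ v ∈ V, v ∈ Wᗮ ∧ v ≠ 0 := by
  have hker := LinearMap.ker_ne_bot_of_finrank_lt
    (f := (W.orthogonalProjectionOnto : H →ₗ[ℂ] W) ∘ₗ V.subtype) h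
  obtain ⟨v, hv, hne⟩ := Submodule.exists_mem_ne_zero_of_ne_bot hker
  refine ⟨v, v.2, ?_, fun h => hne (Subtype.ext h)⟩
  rw [← Submodule.orthogonalProjectionOnto_eq_zero_iff]
  exact hv

variable [CompleteSpace H] {T S : H →L[ℂ] H}

theorem eigenProj_mem (T : H →L[ℂ] H) (c : ℝ) (v : H) :
    eigenProj T c v ∈ Module.End.eigenspace (T : Module.End ℂ H) (c : ℂ) :=
  Submodule.starProjection_apply_mem _ v

theorem apply_eigenProj (T : H →L[ℂ] H) (c : ℝ) (v : H) :
    T (eigenProj T c v) = (c : ℂ) • eigenProj T c v :=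
  Module.End.mem_eigenspace_iff.1 (eigenProj_mem T c v)

theorem inner_eigenProj_left (T : H →L[ℂ] H) (c : ℝ) (u v : H) :
    inner ℂ (eigenProj T c u) v = inner ℂ u (eigenProj T c v) :=
  Submodule.inner_starProjection_left_eq_right _ u v

theorem inner_eigenProj_self (T : H →L[ℂ] H) (c : ℝ) (v : H) :
    inner ℂ v (eigenProj T c v) = ((‖eigenProj T c v‖ ^ 2 : ℝ) : ℂ) := by
  have h : eigenProj T c (eigenProj T c v) = eigenProj T c v :=
    Submodule.starProjection_eq_self_iff.2 (eigenProj_mem T c v)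
  rw [← h, ← inner_eigenProj_left, inner_self_eq_norm_sq_to_K, h]
  simp

theorem eigenProj_eq_zero (T : H →L[ℂ] H) {c : ℝ} {v : H}
    (h : v ∈ (Module.End.eigenspace (T : Module.End ℂ H) (c : ℂ))ᗮ) : eigenProj T c v = 0 :=
  (Submodule.starProjection_apply_eq_zero_iff _).2 h

theorem eigenProj_apply_comm (hs : (T : H →ₗ[ℂ] H).IsSymmetric) (c : ℝ) (v : H) :
    eigenProj T c (T v) = (c : ℂ) • eigenProj T c v := by
  refine ext_inner_right ℂ fun u => ?_
  rw [inner_eigenProj_left, show inner ℂ (T v) (eigenProj T c u) = inner ℂ v (T (eigenProj T c u))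
    from hs v _, apply_eigenProj, inner_smul_right, inner_smul_left, inner_eigenProj_left,
    Complex.conj_ofReal]

theorem hasSum_eigenProj (hs : (T : H →ₗ[ℂ] H).IsSymmetric) (hc : IsCompactOperator T) (v : H) :
    HasSum (fun c : ℝ => eigenProj T c v) v := by
  have hfam : OrthogonalFamily ℂ
      (fun c : ℝ => Module.End.eigenspace (T : Module.End ℂ H) (c : ℂ))
      fun c => (Module.End.eigenspace (T : Module.End ℂ H) (c : ℂ)).subtypeₗᵢ :=
    hs.orthogonalFamily_eigenspaces.comp Complex.ofReal_injective
  have hsum := IsHilbertSum.mkInternal (𝕜 := ℂ)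
    (F := fun c : ℝ => Module.End.eigenspace (T : Module.End ℂ H) (c : ℂ)) hfam (by
      rw [top_le_iff, Submodule.topologicalClosure_eq_top_iff, iSup_eigenspace_ofReal hs]
      exact ContinuousLinearMap.orthogonalComplement_iSup_eigenspaces_eq_bot hc hs)
  have h1 := hsum.hasSum_linearIsometryEquiv_symm (hsum.linearIsometryEquiv v)
  rw [LinearIsometryEquiv.symm_apply_apply] at h1
  convert h1 using 2 with c
  -- Applying the continuous projection to the expansion kills every term except the one at `c`,
  -- which identifies the abstract coordinate.
  have h2 := h1.mapL (eigenProj T c)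
  refine h2.unique ?_
  have h3 : ∀ d : ℝ, d ≠ c → eigenProj T c ((Module.End.eigenspace (T : Module.End ℂ H)
      (d : ℂ)).subtypeₗᵢ ((hsum.linearIsometryEquiv v) d)) = 0 := fun d hd =>
    eigenProj_eq_zero T ((isOrtho_eigenspace hs hd).le (Subtype.property _))
  convert hasSum_single c h3 using 1
  exact (Submodule.starProjection_eq_self_iff.2 (Subtype.property _)).symm

theorem hasSum_inner_eigenProj (hs : (T : H →ₗ[ℂ] H).IsSymmetric) (hc : IsCompactOperator T)
    (u v : H) : HasSum (fun c : ℝ => inner ℂ u (eigenProj T c v)) (inner ℂ u v) :=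
  (hasSum_eigenProj hs hc v).mapL (innerSL ℂ u)

theorem hasSum_norm_sq_eigenProj (hs : (T : H →ₗ[ℂ] H).IsSymmetric) (hc : IsCompactOperator T)
    (v : H) : HasSum (fun c : ℝ => ‖eigenProj T c v‖ ^ 2) (‖v‖ ^ 2) := by
  have h := hasSum_inner_eigenProj hs hc v v
  simp_rw [inner_eigenProj_self] at h
  rw [inner_self_eq_norm_sq_to_K] at h
  have h' := h.mapL Complex.reCLM
  simpa [← Complex.ofReal_pow] using h'

theorem hasSum_quadraticForm (hs : (T : H →ₗ[ℂ] H).IsSymmetric) (hc : IsCompactOperator T)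
    (v : H) : HasSum (fun c : ℝ => c * ‖eigenProj T c v‖ ^ 2) (inner ℂ (T v) v).re := by
  have h := hasSum_inner_eigenProj hs hc (T v) v
  have h1 : ∀ c : ℝ, inner ℂ (T v) (eigenProj T c v) = ((c * ‖eigenProj T c v‖ ^ 2 : ℝ) : ℂ) := by
    intro c
    rw [show inner ℂ (T v) (eigenProj T c v) = inner ℂ v (T (eigenProj T c v)) from hs v _,
      apply_eigenProj, inner_smul_right, inner_eigenProj_self]
    push_cast
    ring
  simp_rw [h1] at h
  exact h.mapL Complex.reCLM

theorem mul_norm_sq_le_quadraticForm (hs : (T : H →ₗ[ℂ] H).IsSymmetric) (hc : IsCompactOperator T)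
    {t : ℝ} {v : H} (hv : v ∈ eigenSpan (T : Module.End ℂ H) t) :
    t * ‖v‖ ^ 2 ≤ (inner ℂ (T v) v).re := by
  refine hasSum_le (fun c => ?_) ((hasSum_norm_sq_eigenProj hs hc v).mul_left t)
    (hasSum_quadraticForm hs hc v)
  rcases le_or_gt t c with h | h
  · gcongr
  · rw [eigenProj_eq_zero T ((isOrtho_eigenspace_eigenSpan hs h).symm.le hv)]
    simp

/-- Only components at eigenvalues below `t` survive, and one of them is nonzero. The strictness is
what produces the contradiction in Weyl's inequality. -/
theorem quadraticForm_lt_mul_norm_sq (hs : (T : H →ₗ[ℂ] H).IsSymmetric) (hc : IsCompactOperator T)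
    {t : ℝ} {v : H} (hv : v ∈ (eigenSpan (T : Module.End ℂ H) t)ᗮ) (hne : v ≠ 0) :
    (inner ℂ (T v) v).re < t * ‖v‖ ^ 2 := by
  have hz : ∀ c : ℝ, t ≤ c → eigenProj T c v = 0 := fun c h =>
    eigenProj_eq_zero T (Submodule.orthogonal_le (eigenspace_le_eigenSpan _ h) hv)
  obtain ⟨c, hcv⟩ : ∃ c : ℝ, eigenProj T c v ≠ 0 := by
    by_contra! h
    have h1 := hasSum_eigenProj hs hc v
    simp_rw [h] at h1
    exact hne (h1.unique hasSum_zero)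
  refine hasSum_lt (i := c) (fun d => ?_) ?_ (hasSum_quadraticForm hs hc v)
    ((hasSum_norm_sq_eigenProj hs hc v).mul_left t)
  · rcases le_or_gt t d with h | h
    · simp [hz d h]
    · show d * _ ≤ t * _
      gcongr
  · have : c < t := not_le.1 fun h => hcv (hz c h)
    have : 0 < ‖eigenProj T c v‖ := norm_pos_iff.2 hcv
    show c * _ < t * _
    gcongr

theorem mul_norm_le_norm_apply_of_mem_eigenSpan (hs : (T : H →ₗ[ℂ] H).IsSymmetric)
    (hc : IsCompactOperator T) {t : ℝ} {v : H} (hv : v ∈ eigenSpan (T : Module.End ℂ H) t) :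
    t * ‖v‖ ≤ ‖T v‖ := by
  rcases eq_or_ne v 0 with rfl | hne
  · simp
  · have h1 := mul_norm_sq_le_quadraticForm hs hc hv
    have h2 : (inner ℂ (T v) v).re ≤ ‖T v‖ * ‖v‖ := re_inner_le_norm (𝕜 := ℂ) (T v) v
    have h3 : 0 < ‖v‖ := norm_pos_iff.2 hne
    refine le_of_mul_le_mul_right ?_ h3
    linarith

/-- `T` is bounded below by `t` on the span, hence on its closure, where it is a closed embedding;
compactness of `T` then makes the unit ball compact. Without this, `finrank` could take its default
value `0` and `eigenCount` would not count. -/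
theorem finiteDimensional_eigenSpan (hs : (T : H →ₗ[ℂ] H).IsSymmetric) (hc : IsCompactOperator T)
    {t : ℝ} (ht : 0 < t) : FiniteDimensional ℂ (eigenSpan (T : Module.End ℂ H) t) := by
  set K := (eigenSpan (T : Module.End ℂ H) t).topologicalClosure with hK
  have hle : eigenSpan (T : Module.End ℂ H) t ≤ K := Submodule.le_topologicalClosure _
  have : CompleteSpace K := (Submodule.isClosed_topologicalClosure _).completeSpace_coe
  have hbound : ∀ v ∈ K, t * ‖v‖ ≤ ‖T v‖ := by
    intro v hv
    have hcl : IsClosed {v : H | t * ‖v‖ ≤ ‖T v‖} :=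
      isClosed_le (continuous_const.mul continuous_norm) T.continuous.norm
    exact closure_minimal (s := (eigenSpan (T : Module.End ℂ H) t : Set H))
      (fun v hv => mul_norm_le_norm_apply_of_mem_eigenSpan hs hc hv) hcl hv
  have hfd : FiniteDimensional ℂ K := by
    have hcK : IsCompactOperator (T ∘L K.subtypeL) := hc.comp_clm K.subtypeL
    have hanti : AntilipschitzWith (Real.toNNReal t⁻¹) (T ∘L K.subtypeL) := by
      refine ContinuousLinearMap.antilipschitz_of_bound _ fun v => ?_
      rw [Real.coe_toNNReal _ (inv_nonneg.2 ht.le), inv_mul_eq_div, le_div_iff₀ ht, mul_comm]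
      exact hbound v v.2
    obtain ⟨C, hC, hCi⟩ := IsCompactOperator.image_closedBall_subset_compact
      (f := ((T ∘L K.subtypeL : K →L[ℂ] H) : K →ₗ[ℂ] H)) hcK 1
    have hemb := hanti.isClosedEmbedding (T ∘L K.subtypeL).uniformContinuous
    refine FiniteDimensional.of_isCompact_closedBall ℂ one_pos (c := (0 : K)) ?_
    exact (hemb.isCompact_preimage hC).of_isClosed_subset Metric.isClosed_closedBall
      (Set.image_subset_iff.1 hCi)
  exact Submodule.finiteDimensional_of_le hle

/-- A form of Weyl's inequality for the eigenvalues of a sum. -/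
theorem eigenCount_le_of_norm_sub_le (hsT : (T : H →ₗ[ℂ] H).IsSymmetric)
    (hcT : IsCompactOperator T) (hsS : (S : H →ₗ[ℂ] H).IsSymmetric) (hcS : IsCompactOperator S)
    {ε t : ℝ} (hε : ‖T - S‖ ≤ ε) (ht : ε < t) :
    eigenCount (T : Module.End ℂ H) t ≤ eigenCount (S : Module.End ℂ H) (t - ε) := by
  have hε0 : 0 ≤ ε := (norm_nonneg _).trans hε
  have := finiteDimensional_eigenSpan hsT hcT (hε0.trans_lt ht)
  have := finiteDimensional_eigenSpan hsS hcS (sub_pos.2 ht)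
  by_contra! hlt
  rw [eigenCount_eq_finrank, eigenCount_eq_finrank] at hlt
  obtain ⟨v, hvT, hvS, hne⟩ := exists_mem_orthogonal_of_finrank_lt hlt
  have h1 := mul_norm_sq_le_quadraticForm hsT hcT hvT
  have h2 := quadraticForm_lt_mul_norm_sq hsS hcS hvS hne
  have h3 : (inner ℂ ((T - S) v) v).re ≤ ε * ‖v‖ ^ 2 := by
    calc (inner ℂ ((T - S) v) v).re ≤ ‖(T - S) v‖ * ‖v‖ := re_inner_le_norm (𝕜 := ℂ) _ _
      _ ≤ (ε * ‖v‖) * ‖v‖ := by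
          gcongr
          exact (T - S).le_of_opNorm_le hε v
      _ = ε * ‖v‖ ^ 2 := by ring
  rw [sub_apply, inner_sub_left, Complex.sub_re] at h3
  linarith

/-- Eigenvectors for distinct eigenvalues are independent in a finite-dimensional space. Thus
eigenvalues can accumulate only at `0`. -/
theorem finite_eigenvalues_ge (hs : (T : H →ₗ[ℂ] H).IsSymmetric) (hc : IsCompactOperator T)
    {t : ℝ} (ht : 0 < t) :
    {s : ℝ | t ≤ s ∧ Module.End.eigenspace (T : Module.End ℂ H) (s : ℂ) ≠ ⊥}.Finite := by
  have := finiteDimensional_eigenSpan hs hc ht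
  set A := {s : ℝ | t ≤ s ∧ Module.End.eigenspace (T : Module.End ℂ H) (s : ℂ) ≠ ⊥}
  choose x hx using fun s : A => Submodule.exists_mem_ne_zero_of_ne_bot s.2.2
  have hli : LinearIndependent ℂ x := Module.End.eigenvectors_linearIndependent'
    (T : Module.End ℂ H) (fun s : A => ((s : ℝ) : ℂ))
    (Complex.ofReal_injective.comp Subtype.val_injective) x fun s => ⟨(hx s).1, (hx s).2⟩
  have hli' : LinearIndependent ℂ
      fun s : A => (⟨x s, eigenspace_le_eigenSpan _ s.2.1 (hx s).1⟩ :
        eigenSpan (T : Module.End ℂ H) t) :=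
    LinearIndependent.of_comp (eigenSpan (T : Module.End ℂ H) t).subtype hli
  exact Set.finite_coe_iff.1 hli'.finite

end CompactSelfAdjoint

/-! ### Ordered eigenvalues: spectral gaps, index sets, stability under perturbation -/

section OrderedEigenvalues

variable {H : Type*} [NormedAddCommGroup H] [InnerProductSpace ℂ H]

theorem eigenCount_eq_zero_of_norm_lt (T : H →L[ℂ] H) {t : ℝ} (h : ‖T‖ < t) :
    eigenCount (T : Module.End ℂ H) t = 0 := by
  have hbot : eigenSpan (T : Module.End ℂ H) t = ⊥ := by
    refine le_bot_iff.1 (eigenSpan_le_iff.2 fun s hs => ?_)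
    rw [eigenspace_eq_bot_of_norm_lt T]
    rw [Complex.norm_real]
    exact (h.trans_le hs).trans_le (Real.le_norm_self s)
  rw [eigenCount_eq_finrank, hbot, finrank_bot]

/-- Ensures that the `sSup` in `posEigenvalue` is a genuine supremum. For `k = 0` the set would
contain all positive reals. -/
theorem bddAbove_eigenCount_ge (T : H →L[ℂ] H) {k : ℕ} (hk : 1 ≤ k) :
    BddAbove {t : ℝ | 0 < t ∧ k ≤ eigenCount (T : Module.End ℂ H) t} := by
  refine ⟨‖T‖, fun t ht => ?_⟩
  by_contra! h
  have := ht.2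
  rw [eigenCount_eq_zero_of_norm_lt T h] at this
  omega

theorem le_posEigenvalue (T : H →L[ℂ] H) {k : ℕ} (hk : 1 ≤ k) {t : ℝ} (ht : 0 < t)
    (h : k ≤ eigenCount (T : Module.End ℂ H) t) : t ≤ posEigenvalue (T : Module.End ℂ H) k :=
  le_csSup (bddAbove_eigenCount_ge T hk) ⟨ht, h⟩

theorem posEigenvalue_le {T : Module.End ℂ H} {k : ℕ} {a : ℝ} (ha : 0 ≤ a)
    (h : ∀ t, 0 < t → k ≤ eigenCount T t → t ≤ a) : posEigenvalue T k ≤ a :=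
  Real.sSup_le (fun t ht => h t ht.1 ht.2) ha

theorem posEigenvalue_nonneg (T : Module.End ℂ H) (k : ℕ) : 0 ≤ posEigenvalue T k :=
  Real.sSup_nonneg fun _ ht => ht.1.le

/-- This reflection reduces negative eigenvalues to positive ones. -/
theorem orderedEigenvalue_neg (T : Module.End ℂ H) (i : ℤ) :
    orderedEigenvalue (-T) (-i) = -orderedEigenvalue T i := by
  unfold orderedEigenvalue
  rcases lt_trichotomy i 0 with h | h | h
  · simp [h, h.not_gt]
  · simp [h]
  · simp [h, h.not_gt]

theorem orderedEigenvalue_of_nat (T : Module.End ℂ H) {k : ℕ} (hk : 1 ≤ k) :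
    orderedEigenvalue T (k : ℤ) = posEigenvalue T k := by
  have : (0 : ℤ) < k := by exact_mod_cast hk
  rw [orderedEigenvalue, if_pos this, Int.natAbs_natCast]

theorem mem_eigenIndices_iff (T : Module.End ℂ H) {c : ℝ} (hc : c ≠ 0) (i : ℤ) :
    i ∈ eigenIndices T c ↔ orderedEigenvalue T i = c :=
  ⟨fun h => h.2, fun h => ⟨show orderedEigenvalue T i ≠ 0 from h ▸ hc, h⟩⟩

theorem isSymmetric_neg {T : H →L[ℂ] H} (hs : (T : H →ₗ[ℂ] H).IsSymmetric) :
    ((-T : H →L[ℂ] H) : H →ₗ[ℂ] H).IsSymmetric := fun x y => by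
  have h : inner ℂ (T x) y = inner ℂ x (T y) := hs x y
  simp [h]

variable [CompleteSpace H] {T S : H →L[ℂ] H}

theorem exists_gap_of_pos (hs : (T : H →ₗ[ℂ] H).IsSymmetric) (hc : IsCompactOperator T) {c : ℝ}
    (hc0 : 0 < c) : ∃ δ, 0 < δ ∧ δ < c ∧ ∀ s : ℝ, |s - c| ≤ δ → s ≠ c →
      Module.End.eigenspace (T : Module.End ℂ H) (s : ℂ) = ⊥ := by
  have hfin := (finite_eigenvalues_ge hs hc (half_pos hc0)).subset
    (Set.sdiff_subset (t := {c}))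
  obtain ⟨r, hr, hball⟩ := Metric.mem_nhds_iff.1
    (hfin.isClosed.isOpen_compl.mem_nhds (x := c) (by simp))
  refine ⟨min (r / 2) (c / 2), by positivity, (min_le_right _ _).trans_lt (half_lt_self hc0),
    fun s hsc hne => ?_⟩
  have h1 : |s - c| < r := (hsc.trans (min_le_left _ _)).trans_lt (half_lt_self hr)
  have h2 : |s - c| ≤ c / 2 := hsc.trans (min_le_right _ _)
  have h3 : c / 2 ≤ s := by
    have := (abs_le.1 h2).1
    linarith
  by_contra hbot
  exact hball (Metric.mem_ball.2 h1) ⟨⟨h3, hbot⟩, hne⟩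

theorem exists_gap (hs : (T : H →ₗ[ℂ] H).IsSymmetric) (hc : IsCompactOperator T) {c : ℝ}
    (hc0 : c ≠ 0) : ∃ δ, 0 < δ ∧ ∀ s : ℝ, |s - c| ≤ δ → s ≠ c →
      Module.End.eigenspace (T : Module.End ℂ H) (s : ℂ) = ⊥ := by
  rcases hc0.lt_or_gt with h | h
  · obtain ⟨δ, hδ, -, hgap⟩ := exists_gap_of_pos (T := -T) (isSymmetric_neg hs) hc.neg (neg_pos.2 h)
    refine ⟨δ, hδ, fun s hsc hne => ?_⟩
    have := hgap (-s) (by rw [← abs_neg]; convert hsc using 2; ring) (by simpa using hne)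
    rw [ContinuousLinearMap.toLinearMap_neg, eigenspace_neg] at this
    simpa using this
  · obtain ⟨δ, hδ, -, hgap⟩ := exists_gap_of_pos hs hc h
    exact ⟨δ, hδ, hgap⟩

theorem eigenCount_eq_finrank_add (hs : (T : H →ₗ[ℂ] H).IsSymmetric) (hc : IsCompactOperator T)
    {c δ : ℝ} (hc0 : 0 < c) (hδ : 0 < δ) (hgap : ∀ s : ℝ, |s - c| ≤ δ → s ≠ c →
      Module.End.eigenspace (T : Module.End ℂ H) (s : ℂ) = ⊥) :
    eigenCount (T : Module.End ℂ H) c =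
      eigenCount (T : Module.End ℂ H) (c + δ) +
        Module.finrank ℂ (Module.End.eigenspace (T : Module.End ℂ H) (c : ℂ)) := by
  set E := Module.End.eigenspace (T : Module.End ℂ H) (c : ℂ)
  have h0 := finiteDimensional_eigenSpan hs hc hc0
  have h1 := finiteDimensional_eigenSpan hs hc (add_pos hc0 hδ)
  have h2 : FiniteDimensional ℂ E :=
    Submodule.finiteDimensional_of_le (eigenspace_le_eigenSpan _ le_rfl)
  have hsup : eigenSpan (T : Module.End ℂ H) c = eigenSpan (T : Module.End ℂ H) (c + δ) ⊔ E := by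
    refine le_antisymm (eigenSpan_le_iff.2 fun s hcs => ?_)
      (sup_le (eigenSpan_antitone _ (by linarith)) (eigenspace_le_eigenSpan _ le_rfl))
    rcases eq_or_ne s c with rfl | hne
    · exact le_sup_right
    · rcases le_or_gt (c + δ) s with h | h
      · exact (eigenspace_le_eigenSpan _ h).trans le_sup_left
      · rw [hgap s (abs_le.2 ⟨by linarith, by linarith⟩) hne]
        exact bot_le
  have hinf : eigenSpan (T : Module.End ℂ H) (c + δ) ⊓ E = ⊥ :=
    ((isOrtho_eigenspace_eigenSpan hs (by linarith : c < c + δ)).symm.disjoint).eq_bot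
  have h3 := Submodule.finrank_sup_add_finrank_inf_eq (eigenSpan (T : Module.End ℂ H) (c + δ)) E
  rw [hinf, finrank_bot, add_zero] at h3
  rw [eigenCount_eq_finrank, eigenCount_eq_finrank, hsup, h3]

theorem eigenCount_le_of_gap_right (hs : (T : H →ₗ[ℂ] H).IsSymmetric) (hc : IsCompactOperator T)
    {c δ t : ℝ} (hc0 : 0 < c) (hδ : 0 < δ) (hgap : ∀ s : ℝ, |s - c| ≤ δ → s ≠ c →
      Module.End.eigenspace (T : Module.End ℂ H) (s : ℂ) = ⊥) (ht : c < t) :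
    eigenCount (T : Module.End ℂ H) t ≤ eigenCount (T : Module.End ℂ H) (c + δ) := by
  have h1 := finiteDimensional_eigenSpan hs hc (add_pos hc0 hδ)
  rw [eigenCount_eq_finrank, eigenCount_eq_finrank]
  refine Submodule.finrank_mono (eigenSpan_le_iff.2 fun s hts => ?_)
  rcases le_or_gt (c + δ) s with h | h
  · exact eigenspace_le_eigenSpan _ h
  · rw [hgap s (abs_le.2 ⟨by linarith, by linarith⟩) (by linarith)]
    exact bot_le

theorem eigenCount_le_of_gap_left (hs : (T : H →ₗ[ℂ] H).IsSymmetric) (hc : IsCompactOperator T)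
    {c δ t : ℝ} (hc0 : 0 < c) (hδ : 0 < δ) (hgap : ∀ s : ℝ, |s - c| ≤ δ → s ≠ c →
      Module.End.eigenspace (T : Module.End ℂ H) (s : ℂ) = ⊥) (ht : c - δ ≤ t) :
    eigenCount (T : Module.End ℂ H) t ≤ eigenCount (T : Module.End ℂ H) c := by
  have h1 := finiteDimensional_eigenSpan hs hc hc0
  rw [eigenCount_eq_finrank, eigenCount_eq_finrank]
  refine Submodule.finrank_mono (eigenSpan_le_iff.2 fun s hts => ?_)
  rcases le_or_gt c s with h | h
  · exact eigenspace_le_eigenSpan _ h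
  · rw [hgap s (abs_le.2 ⟨by linarith, by linarith⟩) h.ne]
    exact bot_le

/-- The counting function is a step function whose only jump in `[c - δ, c + δ]` is at `c`. The
indices with value `c` are those that the jump passes over. -/
theorem posEigenvalue_eq_iff (hs : (T : H →ₗ[ℂ] H).IsSymmetric) (hc : IsCompactOperator T)
    {c δ : ℝ} (hδ : 0 < δ) (hδc : δ < c) (hgap : ∀ s : ℝ, |s - c| ≤ δ → s ≠ c →
      Module.End.eigenspace (T : Module.End ℂ H) (s : ℂ) = ⊥) {k : ℕ} (hk : 1 ≤ k) :
    posEigenvalue (T : Module.End ℂ H) k = c ↔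
      eigenCount (T : Module.End ℂ H) (c + δ) < k ∧ k ≤ eigenCount (T : Module.End ℂ H) c := by
  have hc0 : 0 < c := hδ.trans hδc
  constructor
  · intro h
    constructor
    · by_contra! hle
      have := le_posEigenvalue T hk (add_pos hc0 hδ) hle
      linarith
    · by_contra! hlt
      -- If fewer than `k` eigenvalues are at least `c`, the gap below `c` keeps every admissible
      -- `t` below `c - δ`, so the supremum cannot reach `c`.
      have : posEigenvalue (T : Module.End ℂ H) k ≤ c - δ := by
        refine posEigenvalue_le (by linarith) fun t ht hkt => ?_
        by_contra! h'
        exact absurd (eigenCount_le_of_gap_left hs hc hc0 hδ hgap h'.le) (by omega)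
      linarith
  · rintro ⟨h1, h2⟩
    refine le_antisymm (posEigenvalue_le hc0.le fun t ht hkt => ?_) (le_posEigenvalue T hk hc0 h2)
    by_contra! h'
    exact absurd (eigenCount_le_of_gap_right hs hc hc0 hδ hgap h') (by omega)

/-- Weyl's inequality is used in both directions: `S` has at least `k` eigenvalues above `c - ε`,
and if it had `k` above some `t > c + ε`, then `T` would have `k` above `t - ε > c`, hence above `c
+ δ`. -/
theorem abs_posEigenvalue_sub_le (hsT : (T : H →ₗ[ℂ] H).IsSymmetric)
    (hcT : IsCompactOperator T) (hsS : (S : H →ₗ[ℂ] H).IsSymmetric) (hcS : IsCompactOperator S)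
    {c δ ε : ℝ} (hδ : 0 < δ) (hgap : ∀ s : ℝ, |s - c| ≤ δ → s ≠ c →
      Module.End.eigenspace (T : Module.End ℂ H) (s : ℂ) = ⊥) {k : ℕ} (hk : 1 ≤ k)
    (h1 : eigenCount (T : Module.End ℂ H) (c + δ) < k)
    (h2 : k ≤ eigenCount (T : Module.End ℂ H) c) (hε : ‖S - T‖ ≤ ε) (hεc : ε < c) :
    |posEigenvalue (S : Module.End ℂ H) k - c| ≤ ε := by
  have hε0 : 0 ≤ ε := (norm_nonneg _).trans hε
  have hlow : c - ε ≤ posEigenvalue (S : Module.End ℂ H) k := by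
    refine le_posEigenvalue S hk (sub_pos.2 hεc) (h2.trans ?_)
    exact eigenCount_le_of_norm_sub_le hsT hcT hsS hcS (by rwa [norm_sub_rev]) hεc
  have hupp : posEigenvalue (S : Module.End ℂ H) k ≤ c + ε := by
    refine posEigenvalue_le (by linarith) fun t ht hkt => ?_
    by_contra! h'
    have h3 := eigenCount_le_of_norm_sub_le hsS hcS hsT hcT hε (by linarith : ε < t)
    have h4 := eigenCount_le_of_gap_right hsT hcT (hε0.trans_lt hεc) hδ hgap
      (by linarith : c < t - ε)
    omega
  exact abs_le.2 ⟨by linarith, by linarith⟩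

theorem exists_finset_eigenIndices_of_pos (hs : (T : H →ₗ[ℂ] H).IsSymmetric)
    (hc : IsCompactOperator T) {T' : ℕ → H →L[ℂ] H} (hs' : ∀ n, (T' n : H →ₗ[ℂ] H).IsSymmetric)
    (hc' : ∀ n, IsCompactOperator (T' n)) (hT' : Tendsto T' atTop (𝓝 T)) {c : ℝ} (hc0 : 0 < c) :
    ∃ J : Finset ℤ, eigenIndices (T : Module.End ℂ H) c = J ∧
      J.card = Module.finrank ℂ (Module.End.eigenspace (T : Module.End ℂ H) (c : ℂ)) ∧
      ∀ i ∈ J, Tendsto (fun n => orderedEigenvalue (T' n : Module.End ℂ H) i) atTop (𝓝 c) := by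
  obtain ⟨δ, hδ, hδc, hgap⟩ := exists_gap_of_pos hs hc hc0
  have hcount := eigenCount_eq_finrank_add hs hc hc0 hδ hgap
  refine ⟨(Finset.Ioc (eigenCount (T : Module.End ℂ H) (c + δ))
    (eigenCount (T : Module.End ℂ H) c)).map Nat.castEmbedding, ?_, ?_, ?_⟩
  · ext i
    rw [mem_eigenIndices_iff _ hc0.ne']
    simp only [Finset.coe_map, Set.mem_image, Finset.mem_coe, Finset.mem_Ioc,
      Nat.castEmbedding_apply]
    constructor
    · intro h
      have hi : 0 < i := by
        by_contra! hi
        have : orderedEigenvalue (T : Module.End ℂ H) i ≤ 0 := by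
          unfold orderedEigenvalue
          rw [if_neg hi.not_gt]
          split_ifs
          · exact neg_nonpos.2 (posEigenvalue_nonneg _ _)
          · exact le_rfl
        linarith
      lift i to ℕ using hi.le
      have hi' : 1 ≤ i := by exact_mod_cast hi
      rw [orderedEigenvalue_of_nat _ hi', posEigenvalue_eq_iff hs hc hδ hδc hgap hi'] at h
      exact ⟨i, h, rfl⟩
    · rintro ⟨k, hk, rfl⟩
      have hk' : 1 ≤ k := by omega
      rwa [orderedEigenvalue_of_nat _ hk', posEigenvalue_eq_iff hs hc hδ hδc hgap hk']
  · rw [Finset.card_map, Nat.card_Ioc, hcount]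
    omega
  · intro i hi
    obtain ⟨k, hk, rfl⟩ := Finset.mem_map.1 hi
    rw [Finset.mem_Ioc] at hk
    have hk' : 1 ≤ k := by omega
    have hnorm : Tendsto (fun n => ‖T' n - T‖) atTop (𝓝 0) := tendsto_iff_norm_sub_tendsto_zero.1 hT'
    rw [tendsto_iff_norm_sub_tendsto_zero]
    refine squeeze_zero' (Eventually.of_forall fun n => norm_nonneg _) ?_ hnorm
    filter_upwards [hnorm.eventually_lt_const hc0] with n hn
    rw [Nat.castEmbedding_apply, orderedEigenvalue_of_nat _ hk']
    exact abs_posEigenvalue_sub_le hs hc (hs' n) (hc' n) hδ hgap hk' hk.1 hk.2 le_rfl hn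

/-- The case `c < 0` is the positive case for `-T`, with the indices reflected. -/
theorem exists_finset_eigenIndices (hs : (T : H →ₗ[ℂ] H).IsSymmetric)
    (hc : IsCompactOperator T) {T' : ℕ → H →L[ℂ] H} (hs' : ∀ n, (T' n : H →ₗ[ℂ] H).IsSymmetric)
    (hc' : ∀ n, IsCompactOperator (T' n)) (hT' : Tendsto T' atTop (𝓝 T)) {c : ℝ} (hc0 : c ≠ 0) :
    ∃ J : Finset ℤ, eigenIndices (T : Module.End ℂ H) c = J ∧
      J.card = Module.finrank ℂ (Module.End.eigenspace (T : Module.End ℂ H) (c : ℂ)) ∧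
      ∀ i ∈ J, Tendsto (fun n => orderedEigenvalue (T' n : Module.End ℂ H) i) atTop (𝓝 c) := by
  rcases hc0.lt_or_gt with h | h
  · obtain ⟨J, hJ, hcard, hlim⟩ := exists_finset_eigenIndices_of_pos (T := -T)
      (T' := fun n => -T' n) (isSymmetric_neg hs) hc.neg (fun n => isSymmetric_neg (hs' n)) (fun n => (hc' n).neg) hT'.neg
      (neg_pos.2 h)
    simp_rw [ContinuousLinearMap.toLinearMap_neg] at hJ hcard hlim
    refine ⟨J.map (Equiv.neg ℤ).toEmbedding, ?_, ?_, ?_⟩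
    · ext i
      have h1 : -i ∈ eigenIndices (-(T : Module.End ℂ H)) (-c) ↔ -i ∈ (J : Set ℤ) := by rw [hJ]
      rw [mem_eigenIndices_iff _ (neg_ne_zero.2 hc0), orderedEigenvalue_neg, neg_inj] at h1
      rw [mem_eigenIndices_iff _ hc0, h1]
      simp
    · have h1 := eigenspace_neg (T : Module.End ℂ H) ((-c : ℝ) : ℂ)
      rw [Complex.ofReal_neg, neg_neg, ← Complex.ofReal_neg] at h1
      rw [Finset.card_map, hcard]
      exact congrArg (fun E : Submodule ℂ H => Module.finrank ℂ E) h1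
    · intro i hi
      obtain ⟨j, hj, rfl⟩ := Finset.mem_map.1 hi
      have h1 := (hlim j hj).neg
      rw [neg_neg] at h1
      refine h1.congr fun n => ?_
      rw [← orderedEigenvalue_neg, neg_neg]
      rfl
  · exact exists_finset_eigenIndices_of_pos hs hc hs' hc' hT' h

end OrderedEigenvalues

/-! ### Convergence in `ℓ²` -/

section SquareSummable

variable {ι H : Type*} [NormedAddCommGroup H]

theorem norm_sub_sq_le (x y : H) : ‖x - y‖ ^ 2 ≤ 2 * ‖x‖ ^ 2 + 2 * ‖y‖ ^ 2 := by
  have h1 := norm_sub_le x y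
  have h2 := norm_nonneg (x - y)
  nlinarith [sq_nonneg (‖x‖ - ‖y‖)]

theorem summable_norm_sub_sq {a b : ι → H} {A B : ℝ} (ha : ∀ F : Finset ι, ∑ i ∈ F, ‖a i‖ ^ 2 ≤ A)
    (hb : HasSum (fun i => ‖b i‖ ^ 2) B) : Summable fun i => ‖a i - b i‖ ^ 2 := by
  have hsa : Summable fun i => ‖a i‖ ^ 2 := summable_of_sum_le (fun i => sq_nonneg _) ha
  exact Summable.of_nonneg_of_le (fun i => sq_nonneg _) (fun i => norm_sub_sq_le _ _)
    ((hsa.mul_left 2).add (hb.summable.mul_left 2))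

/-- Pointwise convergence together with convergence of the norms implies convergence in `ℓ²`. -/
theorem tendsto_tsum_norm_sub_sq {a : ℕ → ι → H} {b : ι → H} {A : ℕ → ℝ} {B : ℝ}
    (ha : ∀ n (F : Finset ι), ∑ i ∈ F, ‖a n i‖ ^ 2 ≤ A n) (hb : HasSum (fun i => ‖b i‖ ^ 2) B)
    (hA : Tendsto A atTop (𝓝 B)) (hab : ∀ i, Tendsto (fun n => a n i) atTop (𝓝 (b i))) :
    Tendsto (fun n => ∑' i, ‖a n i - b i‖ ^ 2) atTop (𝓝 0) := by
  classical
  rw [tendsto_order]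
  refine ⟨fun r hr => Eventually.of_forall fun n => hr.trans_le (tsum_nonneg fun i => sq_nonneg _),
    fun ε hε => ?_⟩
  obtain ⟨F, hF⟩ := (hb.eventually_const_lt (sub_lt_self B (by positivity : 0 < ε / 4))).exists
  -- A majorant of all finite sums: the part on `F` tends to `0`, and the mass of `a n` off `F` is
  -- at most `A n` minus its mass on `F`, which tends to the mass of `b` off `F`. The limit is four
  -- times a tail below `ε / 4`.
  have hR : Tendsto (fun n => ∑ i ∈ F, ‖a n i - b i‖ ^ 2 + 2 * (A n - ∑ i ∈ F, ‖a n i‖ ^ 2) +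
      2 * (B - ∑ i ∈ F, ‖b i‖ ^ 2)) atTop (𝓝 (∑ i ∈ F, ‖b i - b i‖ ^ 2 +
      2 * (B - ∑ i ∈ F, ‖b i‖ ^ 2) + 2 * (B - ∑ i ∈ F, ‖b i‖ ^ 2))) := by
    refine ((tendsto_finsetSum _ fun i _ => (((hab i).sub_const _).norm.pow 2)).add
      ((hA.sub (tendsto_finsetSum _ fun i _ => ((hab i).norm.pow 2))).const_mul 2)).add_const _
  have hlt : ∑ i ∈ F, ‖b i - b i‖ ^ 2 + 2 * (B - ∑ i ∈ F, ‖b i‖ ^ 2) +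
      2 * (B - ∑ i ∈ F, ‖b i‖ ^ 2) < ε := by
    simp only [sub_self, norm_zero, ne_eq, OfNat.ofNat_ne_zero, not_false_eq_true, zero_pow,
      Finset.sum_const_zero]
    linarith
  filter_upwards [hR.eventually_lt_const hlt] with n hn
  refine lt_of_le_of_lt (Real.tsum_le_of_sum_le (fun i => sq_nonneg _) fun D => ?_) hn
  have h1 : ∑ i ∈ D, ‖a n i - b i‖ ^ 2 ≤ ∑ i ∈ F ∪ D, ‖a n i - b i‖ ^ 2 :=
    Finset.sum_le_sum_of_subset_of_nonneg Finset.subset_union_right fun i _ _ => sq_nonneg _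
  have hsplit : ∀ u : ι → ℝ, ∑ i ∈ F ∪ D, u i = ∑ i ∈ F, u i + ∑ i ∈ D \ F, u i := fun u => by
    rw [← Finset.union_sdiff_self_eq_union, Finset.sum_union Finset.disjoint_sdiff]
  have h2 : ∑ i ∈ D \ F, ‖a n i - b i‖ ^ 2 ≤
      2 * ∑ i ∈ D \ F, ‖a n i‖ ^ 2 + 2 * ∑ i ∈ D \ F, ‖b i‖ ^ 2 := by
    rw [Finset.mul_sum, Finset.mul_sum, ← Finset.sum_add_distrib]
    exact Finset.sum_le_sum fun i _ => norm_sub_sq_le _ _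
  have h3 := ha n (F ∪ D)
  have h4 : ∑ i ∈ F ∪ D, ‖b i‖ ^ 2 ≤ B := sum_le_hasSum _ (fun i _ => sq_nonneg _) hb
  rw [hsplit] at h1 h3 h4
  linarith

end SquareSummable

/-! ### Convergence of spectral projections -/

section Projections

variable {H : Type*} [NormedAddCommGroup H] [InnerProductSpace ℂ H] {ι κ : Type*} [Fintype ι]
  [Fintype κ]

theorem norm_sq_sum_smul_of_orthonormal {v : ι → H} (hv : Orthonormal ℂ v) (a : ι → ℂ) :
    ‖∑ i, a i • v i‖ ^ 2 = ∑ i, ‖a i‖ ^ 2 := by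
  have h := hv.inner_sum a a Finset.univ
  rw [show inner ℂ (∑ i, a i • v i) (∑ i, a i • v i) = ((‖∑ i, a i • v i‖ ^ 2 : ℝ) : ℂ) by
    rw [inner_self_eq_norm_sq_to_K]; simp] at h
  have h' : ∀ i, (starRingEnd ℂ) (a i) * a i = ((‖a i‖ ^ 2 : ℝ) : ℂ) := fun i => by
    rw [Complex.conj_mul']
    push_cast
    rfl
  simp_rw [h'] at h
  exact_mod_cast h

theorem norm_sq_sub_sum_inner_smul {v : ι → H} (hv : Orthonormal ℂ v) (x : H) :
    ‖x - ∑ i, inner ℂ (v i) x • v i‖ ^ 2 = ‖x‖ ^ 2 - ∑ i, ‖inner ℂ (v i) x‖ ^ 2 := by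
  rw [@norm_sub_sq ℂ, norm_sq_sum_smul_of_orthonormal hv]
  have h : inner ℂ x (∑ i, inner ℂ (v i) x • v i) = ((∑ i, ‖inner ℂ (v i) x‖ ^ 2 : ℝ) : ℂ) := by
    rw [inner_sum, Complex.ofReal_sum]
    refine Finset.sum_congr rfl fun i _ => ?_
    rw [inner_smul_right, ← inner_conj_symm x (v i), Complex.mul_conj']
    push_cast
    rfl
  rw [h]
  simp only [RCLike.re_to_complex, Complex.ofReal_re]
  ring

/-- Both sides equal the common cardinality minus the sum of all `‖⟪e j, v i⟫‖ ^ 2`. So if the `v i`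
are close to the span of the `e j`, the `e j` are equally close to the span of the `v i`. -/
theorem sum_norm_sq_sub_symm {v : ι → H} {e : κ → H} (hv : Orthonormal ℂ v)
    (he : Orthonormal ℂ e) (hcard : Fintype.card ι = Fintype.card κ) :
    ∑ j, ‖e j - ∑ i, inner ℂ (v i) (e j) • v i‖ ^ 2 =
      ∑ i, ‖v i - ∑ j, inner ℂ (e j) (v i) • e j‖ ^ 2 := by
  simp_rw [norm_sq_sub_sum_inner_smul hv, norm_sq_sub_sum_inner_smul he, Finset.sum_sub_distrib,
    hv.norm_eq_one, he.norm_eq_one]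
  rw [Finset.sum_comm]
  simp_rw [norm_inner_symm]
  simp [hcard]

theorem starProjection_eq_sum_inner_smul (K : Submodule ℂ H) [K.HasOrthogonalProjection]
    (b : OrthonormalBasis κ ℂ K) (x : H) :
    K.starProjection x = ∑ j, inner ℂ (b j : H) x • (b j : H) := by
  rw [Submodule.starProjection_apply, b.orthogonalProjectionOnto_apply_eq_sum]
  simp

/-- If the members of orthonormal families approach a subspace of the same dimension, then the
orthogonal projections onto their spans converge strongly to the one onto the subspace. -/
theorem tendsto_sum_inner_smul (K : Submodule ℂ H) [FiniteDimensional ℂ K]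
    (hcard : Fintype.card ι = Module.finrank ℂ K) {v : ℕ → ι → H}
    (hv : ∀ᶠ n in atTop, Orthonormal ℂ (v n))
    (hlim : ∀ i, Tendsto (fun n => ‖v n i - K.starProjection (v n i)‖) atTop (𝓝 0))
    {g' : ℕ → H} {g : H} (hg : Tendsto g' atTop (𝓝 g)) :
    Tendsto (fun n => ∑ i, inner ℂ (v n i) (g' n) • v n i) atTop (𝓝 (K.starProjection g)) := by
  set b := stdOrthonormalBasis ℂ K
  have hbo : Orthonormal ℂ fun j => (b j : H) := b.orthonormal.comp_linearIsometry K.subtypeₗᵢ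
  have hcard' : Fintype.card ι = Fintype.card (Fin (Module.finrank ℂ K)) := by simp [hcard]
  set Q : ℕ → H → H := fun n x => ∑ i, inner ℂ (v n i) x • v n i with hQ
  have hQadd : ∀ n x y, Q n (x + y) = Q n x + Q n y := fun n x y => by
    simp only [hQ, inner_add_right, add_smul, Finset.sum_add_distrib]
  -- Equality of the dimensions enters here, through `sum_norm_sq_sub_symm`.
  have hbasis : ∀ j, Tendsto (fun n => Q n (b j)) atTop (𝓝 (b j : H)) := by
    intro j
    have h0 : Tendsto (fun n => ∑ i, ‖v n i - K.starProjection (v n i)‖ ^ 2) atTop (𝓝 0) := by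
      simpa using tendsto_finsetSum Finset.univ fun i _ => (hlim i).pow 2
    have h1 : Tendsto (fun n => ‖(b j : H) - Q n (b j)‖ ^ 2) atTop (𝓝 0) := by
      refine squeeze_zero' (Eventually.of_forall fun n => sq_nonneg _) ?_ h0
      filter_upwards [hv] with n hn
      simp_rw [starProjection_eq_sum_inner_smul K b, ← sum_norm_sq_sub_symm hn hbo hcard']
      exact Finset.single_le_sum (f := fun j => ‖(b j : H) - Q n (b j)‖ ^ 2)
        (fun _ _ => sq_nonneg _) (Finset.mem_univ j)
    have h2 := h1.sqrt
    simp_rw [Real.sqrt_sq (norm_nonneg _), Real.sqrt_zero, norm_sub_rev (b j : H)] at h2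
    exact tendsto_iff_norm_sub_tendsto_zero.2 h2
  have hK : Tendsto (fun n => Q n (K.starProjection g)) atTop (𝓝 (K.starProjection g)) := by
    have hQsum : ∀ n, Q n (K.starProjection g) = ∑ j, inner ℂ (b j : H) g • Q n (b j) := fun n => by
      rw [starProjection_eq_sum_inner_smul K b]
      simp only [hQ, inner_sum, inner_smul_right, Finset.sum_smul, Finset.smul_sum, smul_smul]
      exact Finset.sum_comm
    simp_rw [hQsum]
    rw [starProjection_eq_sum_inner_smul K b]
    exact tendsto_finsetSum _ fun j _ => (hbasis j).const_smul _
  have hperp : Tendsto (fun n => Q n (g - K.starProjection g)) atTop (𝓝 0) := by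
    have h1 : Tendsto (fun n => ∑ i, ‖v n i - K.starProjection (v n i)‖ * ‖g‖) atTop (𝓝 0) := by
      simpa using tendsto_finsetSum Finset.univ fun i _ => (hlim i).mul_const ‖g‖
    refine squeeze_zero_norm' ?_ h1
    filter_upwards [hv] with n hn
    refine norm_sum_le_of_le _ fun i _ => ?_
    -- The projection is moved to the other side: `⟪v, g - P g⟫ = ⟪v - P v, g⟫`, which is small
    -- because `v` is close to `K`.
    rw [norm_smul, hn.norm_eq_one, mul_one, inner_sub_right,
      ← Submodule.inner_starProjection_left_eq_right, ← inner_sub_left]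
    exact norm_inner_le_norm _ _
  have hdiff : Tendsto (fun n => Q n (g' n - g)) atTop (𝓝 0) := by
    have h1 : Tendsto (fun n => ∑ _i : ι, ‖g' n - g‖) atTop (𝓝 0) := by
      simpa using tendsto_finsetSum (Finset.univ : Finset ι) fun i _ =>
        tendsto_iff_norm_sub_tendsto_zero.1 hg
    refine squeeze_zero_norm' ?_ h1
    filter_upwards [hv] with n hn
    refine norm_sum_le_of_le _ fun i _ => ?_
    rw [norm_smul, hn.norm_eq_one, mul_one]
    refine (norm_inner_le_norm (𝕜 := ℂ) (v n i) (g' n - g)).trans_eq ?_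
    rw [hn.norm_eq_one, one_mul]
  have h := (hK.add hperp).add hdiff
  simp_rw [← hQadd, add_sub_cancel] at h
  simpa using h

end Projections

/-! ### Convergence of the partial eigenvector expansions -/

section SpectralConvergence

variable {H : Type*} [NormedAddCommGroup H] [InnerProductSpace ℂ H]

/-- The part of the expansion of `g` in `ψ` that belongs to the indices in `I` of nonzero
eigenvalues of `T`. -/
noncomputable def partialExpansion (T : Module.End ℂ H) (ψ : ℤ → H) (g : H) (I : Set ℤ) : H :=
  ∑ᶠ i ∈ I ∩ indexSet T, inner ℂ (ψ i) g • ψ i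

open Classical in
theorem partialExpansion_eq_sum (T : Module.End ℂ H) (ψ : ℤ → H) (g : H) (J : Finset ℤ) :
    partialExpansion T ψ g J = ∑ i ∈ J with i ∈ indexSet T, inner ℂ (ψ i) g • ψ i := by
  rw [partialExpansion, ← finsum_mem_coe_finset,
    show (J : Set ℤ) ∩ indexSet T = ((J.filter fun i => i ∈ indexSet T : Finset ℤ) : Set ℤ) by
      ext i; simp]

/-- Bessel's inequality, grouped into disjoint blocks of indices. -/
theorem sum_norm_sq_partialExpansion_le {S : Module.End ℂ H} {ψ : ℤ → H}
    (hψ : IsOrderedEigenbasis S ψ) (g : H) {α : Type*} (F : Finset α) (J : α → Finset ℤ)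
    (hJ : Pairwise fun a b => Disjoint (J a) (J b)) :
    ∑ a ∈ F, ‖partialExpansion S ψ g (J a)‖ ^ 2 ≤ ‖g‖ ^ 2 := by
  classical
  have horth : ∀ K : Finset ℤ, (∀ i ∈ K, i ∈ indexSet S) → Orthonormal ℂ fun i : K => ψ i :=
    fun K hK => hψ.orthonormal.comp (fun i : K => (⟨i, hK i i.2⟩ : indexSet S))
      fun i j h => Subtype.ext (Subtype.mk.inj h)
  have hsq : ∀ K : Finset ℤ, (∀ i ∈ K, i ∈ indexSet S) →
      ‖∑ i ∈ K, inner ℂ (ψ i) g • ψ i‖ ^ 2 = ∑ i ∈ K, ‖inner ℂ (ψ i) g‖ ^ 2 := fun K hK => by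
    have h := norm_sq_sum_smul_of_orthonormal (horth K hK) fun i : K => inner ℂ (ψ i) g
    rwa [Finset.sum_coe_sort K fun i => inner ℂ (ψ i) g • ψ i,
      Finset.sum_coe_sort K fun i => ‖inner ℂ (ψ i) g‖ ^ 2] at h
  have h1 : ∀ a, ‖partialExpansion S ψ g (J a)‖ ^ 2 =
      ∑ i ∈ J a with i ∈ indexSet S, ‖inner ℂ (ψ i) g‖ ^ 2 := fun a => by
    rw [partialExpansion_eq_sum]
    exact hsq _ fun i hi => (Finset.mem_filter.1 hi).2
  have hdisj : (F : Set α).PairwiseDisjoint fun a => (J a).filter fun i => i ∈ indexSet S :=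
    fun a _ b _ hab => Finset.disjoint_filter_filter (hJ hab)
  have h2 : ∑ a ∈ F, ‖partialExpansion S ψ g (J a)‖ ^ 2 =
      ∑ i ∈ F.biUnion fun a => (J a).filter fun i => i ∈ indexSet S, ‖inner ℂ (ψ i) g‖ ^ 2 := by
    rw [Finset.sum_biUnion hdisj]
    exact Finset.sum_congr rfl fun a _ => h1 a
  rw [h2, ← Finset.sum_coe_sort]
  refine (horth _ fun i hi => ?_).sum_inner_products_le g (s := Finset.univ)
  obtain ⟨a, -, ha⟩ := Finset.mem_biUnion.1 hi
  exact (Finset.mem_filter.1 ha).2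

variable [CompleteSpace H] {T : H →L[ℂ] H}

/-- In eigencoordinates `T - c` multiplies the component at `s` by `s - c`; by the gap, every
nonzero component with `s ≠ c` has `|s - c| > δ`. -/
theorem mul_norm_sub_eigenProj_le (hs : (T : H →ₗ[ℂ] H).IsSymmetric) (hc : IsCompactOperator T)
    {c δ : ℝ} (hδ : 0 < δ) (hgap : ∀ s : ℝ, |s - c| ≤ δ → s ≠ c →
      Module.End.eigenspace (T : Module.End ℂ H) (s : ℂ) = ⊥) (u : H) :
    δ * ‖u - eigenProj T c u‖ ≤ ‖T u - (c : ℂ) • u‖ := by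
  refine le_of_sq_le_sq ?_ (norm_nonneg _)
  rw [mul_pow]
  refine hasSum_le (fun s => ?_)
    ((hasSum_norm_sq_eigenProj hs hc (u - eigenProj T c u)).mul_left (δ ^ 2))
    (hasSum_norm_sq_eigenProj hs hc (T u - (c : ℂ) • u))
  have h1 : eigenProj T s (T u - (c : ℂ) • u) = ((s - c : ℝ) : ℂ) • eigenProj T s u := by
    rw [map_sub, map_smul, eigenProj_apply_comm hs, ← sub_smul, Complex.ofReal_sub]
  rw [h1, norm_smul, Complex.norm_real, mul_pow]
  rcases eq_or_ne s c with rfl | hne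
  · have h2 : eigenProj T s (eigenProj T s u) = eigenProj T s u :=
      Submodule.starProjection_eq_self_iff.2 (eigenProj_mem T s u)
    rw [map_sub, h2]
    simp
  · rw [map_sub, eigenProj_eq_zero T ((isOrtho_eigenspace hs hne.symm).le (eigenProj_mem T c u)),
      sub_zero]
    rcases le_or_gt |s - c| δ with h | h
    · have h3 : eigenProj T s u = 0 := by
        have := eigenProj_mem T s u
        rwa [hgap s h hne, Submodule.mem_bot] at this
      simp [h3]
    · rw [Real.norm_eq_abs]
      gcongr

variable {T' : ℕ → H →L[ℂ] H} {ψ : ℕ → ℤ → H} {g' : ℕ → H} {g : H}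

theorem tendsto_partialExpansion (hs : (T : H →ₗ[ℂ] H).IsSymmetric) (hc : IsCompactOperator T)
    (hs' : ∀ n, (T' n : H →ₗ[ℂ] H).IsSymmetric) (hc' : ∀ n, IsCompactOperator (T' n))
    (hT' : Tendsto T' atTop (𝓝 T)) (hψ : ∀ n, IsOrderedEigenbasis (T' n : Module.End ℂ H) (ψ n))
    (hg : Tendsto g' atTop (𝓝 g)) {c : ℝ} (hc0 : c ≠ 0) :
    Tendsto (fun n => partialExpansion (T' n : Module.End ℂ H) (ψ n) (g' n)
      (eigenIndices (T : Module.End ℂ H) c)) atTop (𝓝 (eigenProj T c g)) := by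
  classical
  obtain ⟨J, hJ, hcard, hlim⟩ := exists_finset_eigenIndices hs hc hs' hc' hT' hc0
  obtain ⟨δ, hδ, hgap⟩ := exists_gap hs hc hc0
  have := ContinuousLinearMap.finite_dimensional_eigenspace hc (c : ℂ)
    (Complex.ofReal_ne_zero.2 hc0)
  -- As `c ≠ 0`, for large `n` no index of `J` belongs to a padded zero, so the expansion has all
  -- its terms.
  have hJev : ∀ᶠ n in atTop, ∀ i ∈ J, i ∈ indexSet (T' n : Module.End ℂ H) :=
    (eventually_all_finset J).2 fun i hi => (hlim i hi).eventually_ne hc0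
  have horth : ∀ᶠ n in atTop, Orthonormal ℂ fun i : J => ψ n i := by
    filter_upwards [hJev] with n hn
    exact (hψ n).orthonormal.comp (fun i : J => (⟨i, hn i i.2⟩ : indexSet (T' n : Module.End ℂ H)))
      fun i j h => Subtype.ext (Subtype.mk.inj h)
  have happroach : ∀ i : J, Tendsto (fun n => ‖ψ n i - (Module.End.eigenspace
      (T : Module.End ℂ H) (c : ℂ)).starProjection (ψ n i)‖) atTop (𝓝 0) := by
    intro i
    have h1 : Tendsto (fun n => (‖T' n - T‖ +
        ‖orderedEigenvalue (T' n : Module.End ℂ H) i - c‖) / δ) atTop (𝓝 0) := by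
      simpa using ((tendsto_iff_norm_sub_tendsto_zero.1 hT').add
        (tendsto_iff_norm_sub_tendsto_zero.1 (hlim i i.2))).div_const δ
    refine squeeze_zero' (Eventually.of_forall fun n => norm_nonneg _) ?_ h1
    filter_upwards [hJev, horth] with n hn ho
    rw [le_div_iff₀ hδ, mul_comm]
    refine (mul_norm_sub_eigenProj_le hs hc hδ hgap (ψ n i)).trans ?_
    have he : T' n (ψ n i) = ((orderedEigenvalue (T' n : Module.End ℂ H) i : ℝ) : ℂ) • ψ n i :=
      (hψ n).eigen i (hn i i.2)
    have hsplit : T (ψ n i) - (c : ℂ) • ψ n i = -((T' n - T) (ψ n i)) +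
        ((orderedEigenvalue (T' n : Module.End ℂ H) i - c : ℝ) : ℂ) • ψ n i := by
      rw [sub_apply, he, Complex.ofReal_sub, sub_smul]
      abel
    rw [hsplit]
    refine (norm_add_le _ _).trans ?_
    rw [norm_neg, norm_smul, Complex.norm_real, ho.norm_eq_one i, mul_one]
    gcongr
    simpa [ho.norm_eq_one i] using (T' n - T).le_opNorm (ψ n i)
  have hmain := tendsto_sum_inner_smul (Module.End.eigenspace (T : Module.End ℂ H) (c : ℂ))
    (by rw [Fintype.card_coe, hcard]) horth happroach hg
  refine hmain.congr' ?_
  filter_upwards [hJev] with n hn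
  rw [hJ, partialExpansion_eq_sum, Finset.filter_true_of_mem hn,
    ← Finset.sum_coe_sort J fun i => inner ℂ (ψ n i) (g' n) • ψ n i]

theorem sum_norm_sq_partialExpansion_eigenIndices_le (hs : (T : H →ₗ[ℂ] H).IsSymmetric)
    (hc : IsCompactOperator T) {S : Module.End ℂ H} {ψ : ℤ → H} (hψ : IsOrderedEigenbasis S ψ)
    (g : H) {p : ℝ → Prop} (F : Finset {c : ℝ // c ≠ 0 ∧ p c}) :
    ∑ c ∈ F, ‖partialExpansion S ψ g (eigenIndices (T : Module.End ℂ H) c)‖ ^ 2 ≤ ‖g‖ ^ 2 := by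
  -- The constant sequence `T` suffices, since only finiteness of the index sets is needed.
  choose J hJ using fun c : {c : ℝ // c ≠ 0 ∧ p c} => exists_finset_eigenIndices hs hc
    (T' := fun _ => T) (fun _ => hs) (fun _ => hc) tendsto_const_nhds c.2.1
  simp_rw [fun c => (hJ c).1]
  refine sum_norm_sq_partialExpansion_le hψ g F J fun a b hab => ?_
  show Disjoint (J a) (J b)
  rw [← Finset.disjoint_coe, ← (hJ a).1, ← (hJ b).1, Set.disjoint_left]
  exact fun i ha hb => hab (Subtype.ext (ha.2.symm.trans hb.2))

/-- Parseval without the term at `0`, which vanishes by assumption; numbers that are not eigenvalues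
contribute nothing. -/
theorem hasSum_norm_sq_eigenProj_of_kernel_proj_eq_zero (hs : (T : H →ₗ[ℂ] H).IsSymmetric)
    (hc : IsCompactOperator T) (hg : eigenProj T 0 g = 0) :
    HasSum (fun c : {c : ℝ // c ≠ 0 ∧ Module.End.HasEigenvalue (T : Module.End ℂ H) (c : ℂ)} =>
      ‖eigenProj T c g‖ ^ 2) (‖g‖ ^ 2) := by
  refine (hasSum_subtype_iff_of_support_subset (f := fun c : ℝ => ‖eigenProj T c g‖ ^ 2)
    (s := {c : ℝ | c ≠ 0 ∧ Module.End.HasEigenvalue (T : Module.End ℂ H) (c : ℂ)}) ?_).2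
    (hasSum_norm_sq_eigenProj hs hc g)
  intro c hcs
  have h : eigenProj T c g ≠ 0 := fun h => hcs (by simp [h])
  refine ⟨fun h0 => h (h0 ▸ hg), Module.End.hasEigenvalue_iff.2 fun hbot => h ?_⟩
  have := eigenProj_mem T c g
  rwa [hbot, Submodule.mem_bot] at this

end SpectralConvergence

/-! ### The cut norm controls the operator norm -/

section CutNorm

variable {X : Type*} [MeasurableSpace X] {μ : Measure X}

/-- Needed because the sign sets of an a.e. measurable function are only null measurable. -/
theorem norm_setIntegral_le_of_forall_measurableSet {E : Type*} [NormedAddCommGroup E]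
    [NormedSpace ℝ E] {g : X → E} {K : ℝ} (h : ∀ S, MeasurableSet S → ‖∫ x in S, g x ∂μ‖ ≤ K)
    {S : Set X} (hS : NullMeasurableSet S μ) : ‖∫ x in S, g x ∂μ‖ ≤ K := by
  obtain ⟨S', -, hS', hae⟩ := hS.exists_measurable_superset_ae_eq
  rw [← setIntegral_congr_set hae]
  exact h S' hS'

theorem integral_norm_le_of_forall_setIntegral_real {g : X → ℝ} (hg : Integrable g μ) {K : ℝ}
    (h : ∀ S, MeasurableSet S → ‖∫ x in S, g x ∂μ‖ ≤ K) : ∫ x, ‖g x‖ ∂μ ≤ 2 * K := by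
  rw [integral_norm_eq_pos_sub_neg hg]
  have hm := hg.aestronglyMeasurable.aemeasurable
  have h1 := norm_setIntegral_le_of_forall_measurableSet h
    (nullMeasurableSet_le (aemeasurable_const (b := (0 : ℝ))) hm)
  have h2 := norm_setIntegral_le_of_forall_measurableSet h
    (nullMeasurableSet_le hm (aemeasurable_const (b := (0 : ℝ))))
  have h3 := (abs_le.1 h1).2
  have h4 := (abs_le.1 h2).1
  linarith

/-- The factor 4 counts the positive and negative parts of the real and imaginary parts. -/
theorem integral_norm_le_of_forall_setIntegral {g : X → ℂ} (hg : Integrable g μ) {K : ℝ}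
    (h : ∀ S, MeasurableSet S → ‖∫ x in S, g x ∂μ‖ ≤ K) : ∫ x, ‖g x‖ ∂μ ≤ 4 * K := by
  have hre : ∫ x, ‖(g x).re‖ ∂μ ≤ 2 * K :=
    integral_norm_le_of_forall_setIntegral_real hg.re fun S hS => by
      have h1 : ∫ x in S, (g x).re ∂μ = (∫ x in S, g x ∂μ).re := integral_re hg.integrableOn
      exact (congrArg norm h1).trans_le <| (Complex.abs_re_le_norm _).trans (h S hS)
  have him : ∫ x, ‖(g x).im‖ ∂μ ≤ 2 * K :=
    integral_norm_le_of_forall_setIntegral_real hg.im fun S hS => by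
      have h1 : ∫ x in S, (g x).im ∂μ = (∫ x in S, g x ∂μ).im := integral_im hg.integrableOn
      exact (congrArg norm h1).trans_le <| (Complex.abs_im_le_norm _).trans (h S hS)
  have h3 : ∫ x, ‖g x‖ ∂μ ≤ ∫ x, (‖(g x).re‖ + ‖(g x).im‖) ∂μ :=
    integral_mono hg.norm (hg.re.norm.add hg.im.norm) fun x => Complex.norm_le_abs_re_add_abs_im _
  have h4 : ∫ x, (‖(g x).re‖ + ‖(g x).im‖) ∂μ = ∫ x, ‖(g x).re‖ ∂μ + ∫ x, ‖(g x).im‖ ∂μ :=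
    integral_add hg.re.norm hg.im.norm
  linarith

theorem norm_integral_mul_le_of_bound {a g : X → ℂ} (hg : Integrable g μ) {M K : ℝ}
    (hM : 0 ≤ M) (ha : ∀ x, ‖a x‖ ≤ M) (h : ∀ S, MeasurableSet S → ‖∫ x in S, g x ∂μ‖ ≤ K) :
    ‖∫ x, a x * g x ∂μ‖ ≤ M * (4 * K) := by
  calc ‖∫ x, a x * g x ∂μ‖ ≤ ∫ x, M * ‖g x‖ ∂μ :=
        norm_integral_le_of_norm_le (hg.norm.const_mul M) (Eventually.of_forall fun x => by
          rw [norm_mul]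
          exact mul_le_mul_of_nonneg_right (ha x) (norm_nonneg _))
    _ = M * ∫ x, ‖g x‖ ∂μ := integral_const_mul _ _
    _ ≤ M * (4 * K) := by
        gcongr
        exact integral_norm_le_of_forall_setIntegral hg h

theorem integrable_kernel_mul {u : X × X → ℝ} (hu : AEStronglyMeasurable u (μ.prod μ)) (hu1 : ∀ p, |u p| ≤ 1)
    {k : X × X → ℂ} (hk : Integrable k (μ.prod μ)) :
    Integrable (fun p => (u p : ℂ) * k p) (μ.prod μ) :=
  hk.bdd_mul (c := 1) (Complex.continuous_ofReal.comp_aestronglyMeasurable hu)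
    (Eventually.of_forall fun p => by simpa using hu1 p)

theorem integral_norm_sq_lp (ξ : Lp ℂ 2 μ) : ∫ x, ‖ξ x‖ ^ 2 ∂μ = ‖ξ‖ ^ 2 := by
  have h : inner ℂ ξ ξ = ((∫ x, ‖ξ x‖ ^ 2 ∂μ : ℝ) : ℂ) := by
    rw [L2.inner_def, ← integral_complex_ofReal]
    refine integral_congr_ae (Eventually.of_forall fun x => ?_)
    show inner ℂ (ξ x) (ξ x) = _
    rw [inner_self_eq_norm_sq_to_K]
    simp
  rw [inner_self_eq_norm_sq_to_K] at h
  have h' := congrArg Complex.re h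
  simpa [← Complex.ofReal_pow] using h'.symm

variable [IsProbabilityMeasure μ] {u : X × X → ℝ}

theorem norm_integral_kernel_mul_le (hu1 : ∀ p, |u p| ≤ 1)
    {a b : X → ℂ} (ha : Integrable a μ) (hb : Integrable b μ) :
    ‖∫ p, (u p : ℂ) * (a p.1 * b p.2) ∂(μ.prod μ)‖ ≤ (∫ x, ‖a x‖ ∂μ) * ∫ y, ‖b y‖ ∂μ := by
  rw [← integral_prod_mul]
  refine norm_integral_le_of_norm_le (ha.norm.mul_prod hb.norm) (Eventually.of_forall fun p => ?_)
  rw [norm_mul, norm_mul]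
  exact mul_le_of_le_one_left (by positivity) (by simpa using hu1 p)

/-- One variable is treated at a time, each costing a factor 4; hence `16`. -/
theorem norm_integral_kernel_mul_le_of_bound (hu : AEStronglyMeasurable u (μ.prod μ))
    (hu1 : ∀ p, |u p| ≤ 1) {C : ℝ}
    (hC : ∀ S T, MeasurableSet S → MeasurableSet T → |∫ p in S ×ˢ T, u p ∂(μ.prod μ)| ≤ C)
    {a b : X → ℂ} (ha : AEStronglyMeasurable a μ) (hb : AEStronglyMeasurable b μ) {M M' : ℝ}
    (haM : ∀ x, ‖a x‖ ≤ M) (hbM : ∀ x, ‖b x‖ ≤ M') :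
    ‖∫ p, (u p : ℂ) * (a p.1 * b p.2) ∂(μ.prod μ)‖ ≤ 16 * (M * M') * C := by
  have : Nonempty X := nonempty_of_isProbabilityMeasure μ
  have hM : 0 ≤ M := (norm_nonneg _).trans (haM (Classical.arbitrary X))
  have hM' : 0 ≤ M' := (norm_nonneg _).trans (hbM (Classical.arbitrary X))
  have hai : Integrable a μ := Integrable.of_bound ha M (Eventually.of_forall haM)
  have hbi : Integrable b μ := Integrable.of_bound hb M' (Eventually.of_forall hbM)
  have hone : Integrable (fun _ : X => (1 : ℂ)) μ := integrable_const 1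
  have hub : Integrable (fun p : X × X => (u p : ℂ) * b p.2) (μ.prod μ) := by
    simpa using integrable_kernel_mul hu hu1 (hone.mul_prod hbi)
  have hu' : Integrable (fun p : X × X => (u p : ℂ)) (μ.prod μ) := by
    simpa using integrable_kernel_mul hu hu1 (hone.mul_prod hone)
  have hrows : ∀ S, MeasurableSet S →
      ‖∫ x in S, ∫ y, (u (x, y) : ℂ) * b y ∂μ ∂μ‖ ≤ M' * (4 * C) := by
    intro S hS
    have hSu : Integrable (fun p : X × X => (u p : ℂ)) ((μ.restrict S).prod μ) := by
      have := hu'.integrableOn (s := S ×ˢ Set.univ)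
      rwa [IntegrableOn, ← Measure.prod_restrict, Measure.restrict_univ] at this
    have hSub : Integrable (fun p : X × X => (u p : ℂ) * b p.2) ((μ.restrict S).prod μ) := by
      have := hub.integrableOn (s := S ×ˢ Set.univ)
      rwa [IntegrableOn, ← Measure.prod_restrict, Measure.restrict_univ] at this
    -- With the set `S` fixed in the first variable, the swap turns the row integral into a pairing
    -- of `b` with a function of `y` whose integrals over sets are controlled by `C`.
    rw [integral_integral_swap (f := fun x y => (u (x, y) : ℂ) * b y) hSub]
    simp_rw [integral_mul_const, mul_comm _ (b _)]
    refine norm_integral_mul_le_of_bound hSu.integral_prod_right hM' hbM fun T hT => ?_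
    have hST : Integrable (fun p : X × X => (u p : ℂ)) ((μ.restrict S).prod (μ.restrict T)) := by
      have := hu'.integrableOn (s := S ×ˢ T)
      rwa [IntegrableOn, ← Measure.prod_restrict] at this
    rw [← integral_integral_swap (f := fun x y => (u (x, y) : ℂ)) hST,
      ← setIntegral_prod (fun p : X × X => (u p : ℂ)) hu'.integrableOn, integral_complex_ofReal,
      Complex.norm_real]
    exact hC S T hS hT
  have hfull : Integrable (fun p : X × X => (u p : ℂ) * (a p.1 * b p.2)) (μ.prod μ) :=
    integrable_kernel_mul hu hu1 (hai.mul_prod hbi)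
  rw [integral_prod _ hfull]
  have hrow : ∀ x, ∫ y, (u (x, y) : ℂ) * (a x * b y) ∂μ =
      a x * ∫ y, (u (x, y) : ℂ) * b y ∂μ := fun x => by
    rw [← integral_const_mul]
    exact integral_congr_ae (Eventually.of_forall fun y => by ring)
  simp_rw [hrow]
  refine (norm_integral_mul_le_of_bound hub.integral_prod_left hM haM hrows).trans_eq ?_
  ring

theorem integral_norm_lp_le (ξ : Lp ℂ 2 μ) : ∫ x, ‖ξ x‖ ∂μ ≤ ‖ξ‖ := by
  have hint : Integrable (ξ : X → ℂ) μ := (Lp.memLp ξ).integrable (by norm_num)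
  rw [integral_norm_eq_lintegral_enorm hint.aestronglyMeasurable, ← eLpNorm_one_eq_lintegral_enorm,
    Lp.norm_def]
  exact ENNReal.toReal_mono (Lp.eLpNorm_ne_top ξ)
    (eLpNorm_le_eLpNorm_of_exponent_le (by norm_num) hint.aestronglyMeasurable)

/-- The truncation of an `L²` function at a multiple of its norm. -/
theorem exists_truncation (ξ : Lp ℂ 2 μ) {M : ℝ} (hM : 0 < M) :
    ∃ a b : X → ℂ, AEStronglyMeasurable a μ ∧ Integrable b μ ∧ (∀ x, ξ x = a x + b x) ∧
      (∀ x, ‖a x‖ ≤ M * ‖ξ‖) ∧ (∫ x, ‖a x‖ ∂μ ≤ ‖ξ‖) ∧ ∫ x, ‖b x‖ ∂μ ≤ ‖ξ‖ / M := by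
  classical
  have hξ : Integrable (ξ : X → ℂ) μ := (Lp.memLp ξ).integrable (by norm_num)
  have hsm : StronglyMeasurable (ξ : X → ℂ) := Lp.stronglyMeasurable ξ
  set A : Set X := {x | ‖ξ x‖ ≤ M * ‖ξ‖}
  have hA : MeasurableSet A := hsm.norm.measurable measurableSet_Iic
  refine ⟨A.indicator ξ, Aᶜ.indicator ξ, (hsm.indicator hA).aestronglyMeasurable,
    hξ.indicator hA.compl, fun x => (congrFun (Set.indicator_self_add_compl A ξ) x).symm,
    fun x => ?_, ?_, ?_⟩
  · by_cases hx : x ∈ A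
    · rw [Set.indicator_of_mem hx]
      exact hx
    · rw [Set.indicator_of_notMem hx, norm_zero]
      positivity
  · refine (integral_mono (hξ.indicator hA).norm hξ.norm fun x => ?_).trans (integral_norm_lp_le ξ)
    exact norm_indicator_le_norm_self _ _
  · rcases eq_or_ne ‖ξ‖ 0 with h0 | h0
    · have h1 : ∫ x, ‖Aᶜ.indicator ξ x‖ ∂μ ≤ ∫ x, ‖ξ x‖ ∂μ :=
        integral_mono (hξ.indicator hA.compl).norm hξ.norm fun x => norm_indicator_le_norm_self _ _
      have h2 := integral_norm_lp_le ξ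
      rw [h0, zero_div]
      linarith
    · have hpos : 0 < ‖ξ‖ := lt_of_le_of_ne (norm_nonneg _) h0.symm
      have hsq : Integrable (fun x => ‖ξ x‖ ^ 2) μ := (Lp.memLp ξ).norm.integrable_sq
      -- Off `A` the value exceeds `M * ‖ξ‖`, so it is at most its square divided by `M * ‖ξ‖`.
      have h1 : ∫ x, ‖Aᶜ.indicator ξ x‖ ∂μ ≤ ∫ x, ‖ξ x‖ ^ 2 / (M * ‖ξ‖) ∂μ := by
        refine integral_mono (hξ.indicator hA.compl).norm (hsq.div_const _) fun x => ?_
        show ‖Aᶜ.indicator ξ x‖ ≤ ‖ξ x‖ ^ 2 / (M * ‖ξ‖)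
        by_cases hx : x ∈ A
        · rw [Set.indicator_of_notMem (by simpa using hx), norm_zero]
          positivity
        · rw [Set.indicator_of_mem (by simpa using hx), le_div_iff₀ (by positivity), sq]
          gcongr
          exact (not_le.1 hx).le
      refine h1.trans_eq ?_
      rw [integral_div, integral_norm_sq_lp]
      field_simp

/-- The product of the two truncations is controlled by the cut bound `C`. The two remaining
products contain a remainder of `L¹` norm at most `1 / M` times the `L²` norm, and there `|u| ≤ 1`
suffices. -/
theorem norm_integral_kernel_mul_lp_le (hu : AEStronglyMeasurable u (μ.prod μ))
    (hu1 : ∀ p, |u p| ≤ 1) {C : ℝ}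
    (hC : ∀ S T, MeasurableSet S → MeasurableSet T → |∫ p in S ×ˢ T, u p ∂(μ.prod μ)| ≤ C)
    (η ξ : Lp ℂ 2 μ) {M : ℝ} (hM : 0 < M) :
    ‖∫ p, (u p : ℂ) * ((starRingEnd ℂ) (η p.1) * ξ p.2) ∂(μ.prod μ)‖ ≤
      (16 * M ^ 2 * C + 2 / M) * (‖η‖ * ‖ξ‖) := by
  obtain ⟨a, b, ha, hb, hab, haM, ha1, hb1⟩ := exists_truncation η hM
  obtain ⟨a', b', ha', hb', hab', haM', ha1', hb1'⟩ := exists_truncation ξ hM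
  have hai : Integrable a μ := Integrable.of_bound ha _ (Eventually.of_forall haM)
  have hai' : Integrable a' μ := Integrable.of_bound ha' _ (Eventually.of_forall haM')
  have hξ : Integrable (ξ : X → ℂ) μ := (Lp.memLp ξ).integrable (by norm_num)
  have hconj : ∀ {g : X → ℂ}, Integrable g μ → Integrable (fun x => (starRingEnd ℂ) (g x)) μ :=
    fun hg => Complex.conjLIE.toContinuousLinearEquiv.toContinuousLinearMap.integrable_comp hg
  have hsplit : ∫ p, (u p : ℂ) * ((starRingEnd ℂ) (η p.1) * ξ p.2) ∂(μ.prod μ) =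
      ∫ p, (u p : ℂ) * ((starRingEnd ℂ) (a p.1) * a' p.2) ∂(μ.prod μ) +
        ∫ p, (u p : ℂ) * ((starRingEnd ℂ) (a p.1) * b' p.2) ∂(μ.prod μ) +
        ∫ p, (u p : ℂ) * ((starRingEnd ℂ) (b p.1) * ξ p.2) ∂(μ.prod μ) := by
    have i1 := integrable_kernel_mul hu hu1 ((hconj hai).mul_prod hai')
    have i2 := integrable_kernel_mul hu hu1 ((hconj hai).mul_prod hb')
    have i3 := integrable_kernel_mul hu hu1 ((hconj hb).mul_prod hξ)
    have i12 : Integrable (fun p => (u p : ℂ) * ((starRingEnd ℂ) (a p.1) * a' p.2) +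
        (u p : ℂ) * ((starRingEnd ℂ) (a p.1) * b' p.2)) (μ.prod μ) := i1.add i2
    rw [← integral_add i1 i2, ← integral_add i12 i3]
    refine integral_congr_ae (Eventually.of_forall fun p => ?_)
    simp only [hab, hab', map_add]
    ring
  have e1 := norm_integral_kernel_mul_le_of_bound hu hu1 hC (hconj hai).aestronglyMeasurable ha'
    (fun x => (RCLike.norm_conj (a x)).trans_le (haM x)) haM'
  have e2 := norm_integral_kernel_mul_le (μ := μ) hu1 (hconj hai) hb'
  have e3 := norm_integral_kernel_mul_le (μ := μ) hu1 (hconj hb) hξ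
  simp_rw [RCLike.norm_conj] at e2 e3
  have e2' : (∫ x, ‖a x‖ ∂μ) * ∫ y, ‖b' y‖ ∂μ ≤ ‖η‖ * (‖ξ‖ / M) :=
    mul_le_mul ha1 hb1' (integral_nonneg fun _ => norm_nonneg _) (norm_nonneg _)
  have e3' : (∫ x, ‖b x‖ ∂μ) * ∫ y, ‖ξ y‖ ∂μ ≤ ‖η‖ / M * ‖ξ‖ :=
    mul_le_mul hb1 (integral_norm_lp_le ξ) (integral_nonneg fun _ => norm_nonneg _) (by positivity)
  rw [hsplit]
  refine (norm_add₃_le.trans (add_le_add_three e1 (e2.trans e2') (e3.trans e3'))).trans_eq ?_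
  ring

theorem Graphon.inner_op (w : Graphon μ) (η ξ : Lp ℂ 2 μ) :
    inner ℂ η (w.op ξ) =
      ∫ p, (w.toFun p.1 p.2 : ℂ) * ((starRingEnd ℂ) (η p.1) * ξ p.2) ∂(μ.prod μ) := by
  have hη : Integrable (fun x => (starRingEnd ℂ) (η x)) μ :=
    Complex.conjLIE.toContinuousLinearEquiv.toContinuousLinearMap.integrable_comp
      ((Lp.memLp η).integrable (by norm_num))
  have hξ : Integrable (ξ : X → ℂ) μ := (Lp.memLp ξ).integrable (by norm_num)
  have hint := integrable_kernel_mul (u := fun p => w.toFun p.1 p.2)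
    w.aemeasurable'.aestronglyMeasurable
    (fun p => abs_le.2 ⟨by linarith [w.nonneg' p.1 p.2], w.le_one' p.1 p.2⟩) (hη.mul_prod hξ)
  rw [L2.inner_def, integral_prod _ hint]
  refine integral_congr_ae ?_
  filter_upwards [(w.memLp_opFun ξ).coeFn_toLp] with x hx
  have hx' : w.op ξ x = w.opFun ξ x := hx
  rw [hx', RCLike.inner_apply, Graphon.opFun, mul_comm, ← integral_const_mul]
  exact integral_congr_ae (Eventually.of_forall fun y => by ring)

theorem Graphon.isSymmetric_op (w : Graphon μ) :
    (w.op : Lp ℂ 2 μ →ₗ[ℂ] Lp ℂ 2 μ).IsSymmetric := by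
  intro η ξ
  show inner ℂ (w.op η) ξ = inner ℂ η (w.op ξ)
  rw [← inner_conj_symm, w.inner_op, w.inner_op, ← integral_conj, ← integral_prod_swap]
  refine integral_congr_ae ?_
  filter_upwards [w.symm'] with p hp
  simp only [map_mul, Complex.conj_ofReal, Complex.conj_conj, Prod.fst_swap, Prod.snd_swap, hp]
  ring

theorem Graphon.abs_setIntegral_sub_le_cutNorm (w₁ w₂ : Graphon μ) {S T : Set X}
    (hS : MeasurableSet S) (hT : MeasurableSet T) :
    |∫ p in S ×ˢ T, (w₁.toFun p.1 p.2 - w₂.toFun p.1 p.2) ∂(μ.prod μ)| ≤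
      cutNorm μ fun x y => w₁.toFun x y - w₂.toFun x y := by
  refine le_csSup ⟨1, ?_⟩ ⟨S, T, hS, hT, rfl⟩
  rintro r ⟨S, T, -, -, rfl⟩
  have h := norm_setIntegral_le_of_norm_le_const (μ := μ.prod μ) (s := S ×ˢ T) (C := 1)
    (f := fun p => w₁.toFun p.1 p.2 - w₂.toFun p.1 p.2) (measure_lt_top _ _) fun p _ => by
      rw [Real.norm_eq_abs, abs_le]
      constructor <;> linarith [w₁.nonneg' p.1 p.2, w₁.le_one' p.1 p.2, w₂.nonneg' p.1 p.2,
        w₂.le_one' p.1 p.2]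
  rw [one_mul] at h
  exact h.trans measureReal_le_one

theorem Graphon.norm_op_sub_op_le (w₁ w₂ : Graphon μ) {M : ℝ} (hM : 0 < M) :
    ‖w₁.op - w₂.op‖ ≤
      16 * M ^ 2 * cutNorm μ (fun x y => w₁.toFun x y - w₂.toFun x y) + 2 / M := by
  set C := cutNorm μ (fun x y => w₁.toFun x y - w₂.toFun x y)
  have hu : AEStronglyMeasurable (fun p : X × X => w₁.toFun p.1 p.2 - w₂.toFun p.1 p.2)
      (μ.prod μ) := (w₁.aemeasurable'.sub w₂.aemeasurable').aestronglyMeasurable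
  have hu1 : ∀ p : X × X, |w₁.toFun p.1 p.2 - w₂.toFun p.1 p.2| ≤ 1 := fun p => by
    rw [abs_le]
    constructor <;> linarith [w₁.nonneg' p.1 p.2, w₁.le_one' p.1 p.2, w₂.nonneg' p.1 p.2,
      w₂.le_one' p.1 p.2]
  have hC : ∀ S T, MeasurableSet S → MeasurableSet T →
      |∫ p in S ×ˢ T, (w₁.toFun p.1 p.2 - w₂.toFun p.1 p.2) ∂(μ.prod μ)| ≤ C :=
    fun S T hS hT => w₁.abs_setIntegral_sub_le_cutNorm w₂ hS hT
  have hC0 : 0 ≤ C := (abs_nonneg _).trans (hC ∅ ∅ MeasurableSet.empty MeasurableSet.empty)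
  have hinner : ∀ η ξ : Lp ℂ 2 μ, ‖inner ℂ η ((w₁.op - w₂.op) ξ)‖ ≤
      (16 * M ^ 2 * C + 2 / M) * (‖η‖ * ‖ξ‖) := by
    intro η ξ
    have hη : Integrable (fun x => (starRingEnd ℂ) (η x)) μ :=
      Complex.conjLIE.toContinuousLinearEquiv.toContinuousLinearMap.integrable_comp
        ((Lp.memLp η).integrable (by norm_num))
    have hξ : Integrable (ξ : X → ℂ) μ := (Lp.memLp ξ).integrable (by norm_num)
    have hint : ∀ w : Graphon μ, Integrable (fun p : X × X => (w.toFun p.1 p.2 : ℂ) *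
        ((starRingEnd ℂ) (η p.1) * ξ p.2)) (μ.prod μ) := fun w =>
      integrable_kernel_mul (u := fun p => w.toFun p.1 p.2) w.aemeasurable'.aestronglyMeasurable
        (fun p => abs_le.2 ⟨by linarith [w.nonneg' p.1 p.2], w.le_one' p.1 p.2⟩) (hη.mul_prod hξ)
    rw [sub_apply, inner_sub_right, w₁.inner_op, w₂.inner_op,
      ← integral_sub (hint w₁) (hint w₂)]
    refine le_trans (le_of_eq ?_) (norm_integral_kernel_mul_lp_le hu hu1 hC η ξ hM)
    congr 1
    refine integral_congr_ae (Eventually.of_forall fun p => ?_)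
    simp only [Complex.ofReal_sub]
    ring
  refine ContinuousLinearMap.opNorm_le_bound _ (by positivity) fun ξ => ?_
  rcases eq_or_ne ((w₁.op - w₂.op) ξ) 0 with h0 | h0
  · rw [h0, norm_zero]
    positivity
  -- The form is tested on the image vector itself, and one factor of its norm is cancelled.
  · have h1 := hinner ((w₁.op - w₂.op) ξ) ξ
    rw [inner_self_eq_norm_sq_to_K, norm_pow, RCLike.norm_ofReal, abs_norm] at h1
    have h2 : 0 < ‖(w₁.op - w₂.op) ξ‖ := norm_pos_iff.2 h0
    refine le_of_mul_le_mul_right ?_ h2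
    nlinarith

theorem tendsto_op_of_tendsto_cutNorm {w' : ℕ → Graphon μ} {w : Graphon μ}
    (h : Tendsto (fun n => cutNorm μ (fun x y => (w' n).toFun x y - w.toFun x y)) atTop (𝓝 0)) :
    Tendsto (fun n => (w' n).op) atTop (𝓝 w.op) := by
  rw [tendsto_iff_norm_sub_tendsto_zero, tendsto_order]
  refine ⟨fun r hr => Eventually.of_forall fun n => hr.trans_le (norm_nonneg _), fun ε hε => ?_⟩
  -- The truncation level `M = 4 / ε` makes the remainder `2 / M` equal to `ε / 2`.
  have h1 := (h.const_mul (16 * (4 / ε) ^ 2)).add_const (2 / (4 / ε))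
  have hlt : 16 * (4 / ε) ^ 2 * 0 + 2 / (4 / ε) < ε := by
    have : 2 / (4 / ε) = ε / 2 := by
      field_simp
      norm_num
    rw [this]
    linarith
  filter_upwards [h1.eventually_lt_const hlt] with n hn
  exact ((w' n).norm_op_sub_op_le w (by positivity)).trans_lt hn

end CutNorm

/-! ### Transport of ordered eigenvalues along isometries -/

section Transport

variable {E H : Type*} [NormedAddCommGroup E] [InnerProductSpace ℂ E] [NormedAddCommGroup H]
  [InnerProductSpace ℂ H] {A : Module.End ℂ E} {T : Module.End ℂ H} {V : E →ₗᵢ[ℂ] H} {r : ℝ}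

/-- For `s ≠ 0` an eigenvector is a multiple of its image under `T`, hence lies in the range of `V`,
where `T` acts as `r` times `A`. At `s = 0` this fails: the kernel of `T` may be larger. -/
theorem eigenspace_eq_map (hrange : ∀ x, T x ∈ LinearMap.range V.toLinearMap)
    (hV : ∀ x, T (V x) = (r : ℂ) • V (A x)) (hr : 0 < r) {s : ℝ} (hs : s ≠ 0) :
    Module.End.eigenspace T (s : ℂ) =
      (Module.End.eigenspace A ((s / r : ℝ) : ℂ)).map V.toLinearMap := by
  have hs' : (s : ℂ) ≠ 0 := Complex.ofReal_ne_zero.2 hs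
  have hr' : (r : ℂ) ≠ 0 := Complex.ofReal_ne_zero.2 hr.ne'
  have key : ∀ y, T (V y) = (s : ℂ) • V y ↔ A y = ((s / r : ℝ) : ℂ) • y := fun y => by
    rw [hV, ← V.map_smul, ← V.map_smul, V.injective.eq_iff, Complex.ofReal_div, div_eq_inv_mul,
      mul_smul, eq_inv_smul_iff₀ hr']
  ext x
  rw [Module.End.mem_eigenspace_iff, Submodule.mem_map]
  constructor
  · intro hx
    obtain ⟨y, hy⟩ : x ∈ LinearMap.range V.toLinearMap := by
      have h := hrange x
      rw [hx] at h
      exact (Submodule.smul_mem_iff _ hs').1 h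
    obtain rfl : V y = x := hy
    exact ⟨y, Module.End.mem_eigenspace_iff.2 ((key y).1 hx), rfl⟩
  · rintro ⟨y, hy, rfl⟩
    exact (key y).2 (Module.End.mem_eigenspace_iff.1 hy)

theorem eigenSpan_eq_map (hrange : ∀ x, T x ∈ LinearMap.range V.toLinearMap)
    (hV : ∀ x, T (V x) = (r : ℂ) • V (A x)) (hr : 0 < r) {t : ℝ} (ht : 0 < t) :
    eigenSpan T t = (eigenSpan A (t / r)).map V.toLinearMap := by
  refine le_antisymm (eigenSpan_le_iff.2 fun s hs => ?_) ?_
  · rw [eigenspace_eq_map hrange hV hr (ht.trans_le hs).ne']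
    exact Submodule.map_mono (eigenspace_le_eigenSpan A (by gcongr))
  · rw [Submodule.map_le_iff_le_comap, eigenSpan_le_iff]
    intro s hs
    have hts : t ≤ s * r := (div_le_iff₀ hr).1 hs
    rw [← Submodule.map_le_iff_le_comap]
    refine le_trans (le_of_eq ?_) (eigenspace_le_eigenSpan T hts)
    rw [eigenspace_eq_map hrange hV hr (ht.trans_le hts).ne', mul_div_cancel_right₀ _ hr.ne']

theorem eigenCount_eq_of_isometry (hrange : ∀ x, T x ∈ LinearMap.range V.toLinearMap)
    (hV : ∀ x, T (V x) = (r : ℂ) • V (A x)) (hr : 0 < r) {t : ℝ} (ht : 0 < t) :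
    eigenCount T t = eigenCount A (t / r) := by
  rw [eigenCount_eq_finrank, eigenCount_eq_finrank, eigenSpan_eq_map hrange hV hr ht]
  exact (Submodule.equivMapOfInjective V.toLinearMap V.injective _).finrank_eq.symm

open scoped Pointwise in
theorem posEigenvalue_eq_mul (hrange : ∀ x, T x ∈ LinearMap.range V.toLinearMap)
    (hV : ∀ x, T (V x) = (r : ℂ) • V (A x)) (hr : 0 < r) (k : ℕ) :
    posEigenvalue T k = r * posEigenvalue A k := by
  have hset : {t : ℝ | 0 < t ∧ k ≤ eigenCount T t} =
      r • {t : ℝ | 0 < t ∧ k ≤ eigenCount A t} := by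
    ext t
    rw [Set.mem_smul_set_iff_inv_smul_mem₀ hr.ne', smul_eq_mul, inv_mul_eq_div]
    constructor
    · rintro ⟨h1, h2⟩
      exact ⟨div_pos h1 hr, by rwa [← eigenCount_eq_of_isometry hrange hV hr h1]⟩
    · rintro ⟨h1, h2⟩
      have h3 : 0 < t := by simpa [hr] using (lt_div_iff₀ hr).1 h1
      exact ⟨h3, by rwa [eigenCount_eq_of_isometry hrange hV hr h3]⟩
  rw [posEigenvalue, hset, Real.sSup_smul_of_nonneg hr.le, smul_eq_mul, posEigenvalue]

theorem orderedEigenvalue_eq_mul (hrange : ∀ x, T x ∈ LinearMap.range V.toLinearMap)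
    (hV : ∀ x, T (V x) = (r : ℂ) • V (A x)) (hr : 0 < r) (i : ℤ) :
    orderedEigenvalue T i = r * orderedEigenvalue A i := by
  have hneg := posEigenvalue_eq_mul (T := -T) (A := -A) (V := V)
    (fun x => by
      rw [LinearMap.neg_apply]
      exact neg_mem (hrange x))
    (fun x => by rw [LinearMap.neg_apply, LinearMap.neg_apply, hV, map_neg, smul_neg]) hr
  unfold orderedEigenvalue
  rw [posEigenvalue_eq_mul hrange hV hr, hneg]
  split_ifs <;> ring

theorem indexSet_eq_of_isometry (hrange : ∀ x, T x ∈ LinearMap.range V.toLinearMap)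
    (hV : ∀ x, T (V x) = (r : ℂ) • V (A x)) (hr : 0 < r) : indexSet T = indexSet A := by
  ext i
  show orderedEigenvalue T i ≠ 0 ↔ orderedEigenvalue A i ≠ 0
  rw [orderedEigenvalue_eq_mul hrange hV hr, mul_ne_zero_iff]
  exact and_iff_right hr.ne'

theorem IsOrderedEigenbasis.map_isometry (hrange : ∀ x, T x ∈ LinearMap.range V.toLinearMap)
    (hV : ∀ x, T (V x) = (r : ℂ) • V (A x)) (hr : 0 < r) {φ : ℤ → E}
    (hφ : IsOrderedEigenbasis A φ) : IsOrderedEigenbasis T fun i => V (φ i) := by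
  have hidx := indexSet_eq_of_isometry hrange hV hr
  refine ⟨fun i hi => ?_, ?_⟩
  · rw [hV, hφ.eigen i (hidx ▸ hi), map_smul, smul_smul, orderedEigenvalue_eq_mul hrange hV hr,
      Complex.ofReal_mul]
  · rw [hidx]
    exact hφ.orthonormal.comp_linearIsometry V

end Transport

/-! ### Graph signals in `L²(X)` -/

section SignalIsometry

variable {X : Type*} [MeasurableSpace X] {μ : Measure X}

theorem volume_interval {N : ℕ} (k : Fin N) : volume (interval N k) = ENNReal.ofReal (1 / N) := by
  have hN : (0 : ℝ) < N := by exact_mod_cast k.pos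
  have himage : Subtype.val '' interval N k = Set.Ico ((k : ℝ) / N) (((k : ℝ) + 1) / N) := by
    ext t
    constructor
    · rintro ⟨s, hs, rfl⟩
      exact hs
    · intro ht
      have h0 : 0 ≤ t := le_trans (by positivity) ht.1
      have h1 : ((k : ℝ) + 1) / N ≤ 1 := by
        rw [div_le_one hN]
        exact_mod_cast k.isLt
      exact ⟨⟨t, h0, ht.2.le.trans h1⟩, ht, rfl⟩
  rw [unitInterval.volume_apply, himage, Real.volume_Ico]
  congr 1
  ring

theorem interval_injective {N : ℕ} {k l : Fin N} {t : unitInterval} (hk : t ∈ interval N k)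
    (hl : t ∈ interval N l) : k = l := by
  have hN : (0 : ℝ) < N := by exact_mod_cast k.pos
  have h1 : (k : ℝ) < l + 1 := (div_lt_div_iff_of_pos_right hN).1 (hk.1.trans_lt hl.2)
  have h2 : (l : ℝ) < k + 1 := (div_lt_div_iff_of_pos_right hN).1 (hl.1.trans_lt hk.2)
  have h3 : (k : ℕ) < l + 1 := by exact_mod_cast h1
  have h4 : (l : ℕ) < k + 1 := by exact_mod_cast h2
  exact Fin.ext (by omega)

/-- The part of `X` that represents the vertex `k`. -/
def cell (σ : IsoModZero μ) (N : ℕ) (k : Fin N) : Set X := σ.invFun ⁻¹' interval N k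

theorem nullMeasurableSet_cell (σ : IsoModZero μ) (N : ℕ) (k : Fin N) :
    NullMeasurableSet (cell σ N k) μ :=
  σ.nullMeasurable_invFun (measurableSet_interval N k)

theorem measureReal_cell (σ : IsoModZero μ) {N : ℕ} (k : Fin N) :
    μ.real (cell σ N k) = 1 / N := by
  rw [measureReal_def, cell, σ.measure_preimage_invFun _ (measurableSet_interval N k),
    volume_interval, ENNReal.toReal_ofReal (by positivity)]

theorem signalFun_of_mem (σ : IsoModZero μ) {N : ℕ} (f : EuclideanSpace ℂ (Fin N)) {x : X}
    {k : Fin N} (hx : x ∈ cell σ N k) : signalFun σ f x = (Real.sqrt N : ℂ) * f k := by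
  unfold signalFun
  rw [Finset.sum_eq_single k]
  · exact if_pos hx
  · intro l _ hl
    rw [if_neg fun h => hl (interval_injective h hx)]
  · simp

/-- The half-open intervals leave out the endpoint `1`, and everything if `N = 0`. -/
theorem signalFun_of_notMem (σ : IsoModZero μ) {N : ℕ} (f : EuclideanSpace ℂ (Fin N)) {x : X}
    (hx : ∀ k, x ∉ cell σ N k) : signalFun σ f x = 0 :=
  Finset.sum_eq_zero fun k _ => if_neg (hx k)

theorem integral_indicator_cell (σ : IsoModZero μ) {N : ℕ} (k : Fin N) (c : ℂ) :
    ∫ x, (cell σ N k).indicator (fun _ => c) x ∂μ = (1 / N : ℂ) * c := by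
  rw [integral_indicator₀ (nullMeasurableSet_cell σ N k), setIntegral_const, measureReal_cell,
    Complex.real_smul]
  push_cast
  rfl

theorem graphGraphon_of_mem (σ : IsoModZero μ) {N : ℕ} (G : SimpleGraph (Fin N)) {x y : X}
    {k l : Fin N} (hx : x ∈ cell σ N k) (hy : y ∈ cell σ N l) [Decidable (G.Adj k l)] :
    (graphGraphon σ G).toFun x y = if G.Adj k l then 1 else 0 := by
  show graphKernel G (σ.invFun x) (σ.invFun y) = _
  unfold graphKernel
  congr 1
  refine propext ⟨?_, fun h => ⟨k, l, h, hx, hy⟩⟩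
  rintro ⟨k', l', h, hx', hy'⟩
  rwa [interval_injective hx hx', interval_injective hy hy']

theorem graphGraphon_of_notMem (σ : IsoModZero μ) {N : ℕ} (G : SimpleGraph (Fin N)) {x y : X}
    (h : (∀ k, x ∉ cell σ N k) ∨ ∀ l, y ∉ cell σ N l) : (graphGraphon σ G).toFun x y = 0 := by
  refine if_neg ?_
  rintro ⟨k, l, -, hx, hy⟩
  exact h.elim (fun h => h k hx) fun h => h l hy

open Classical in
/-- The graph signal `g` such that `T_{w_G} ξ = g^X`. -/
noncomputable def cellAverage (σ : IsoModZero μ) {N : ℕ} (G : SimpleGraph (Fin N)) (ξ : X → ℂ) :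
    EuclideanSpace ℂ (Fin N) :=
  WithLp.toLp 2 fun k =>
    (Real.sqrt N : ℂ)⁻¹ * ∑ l, G.adjMatrix ℂ k l * ∫ y in cell σ N l, ξ y ∂μ

/-- The kernel is constant on products of cells, so every image is a step function. This gives both
finite rank and the range condition needed for transport. -/
theorem opFun_graphGraphon (σ : IsoModZero μ) {N : ℕ} (G : SimpleGraph (Fin N)) {ξ : X → ℂ}
    (hξ : Integrable ξ μ) (x : X) :
    (graphGraphon σ G).opFun ξ x = signalFun σ (cellAverage σ G ξ) x := by
  classical
  by_cases hx : ∃ k, x ∈ cell σ N k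
  · obtain ⟨k, hk⟩ := hx
    have hN : (Real.sqrt N : ℂ) ≠ 0 :=
      Complex.ofReal_ne_zero.2 (Real.sqrt_pos.2 (by exact_mod_cast k.pos)).ne'
    rw [signalFun_of_mem σ _ hk]
    show _ = (Real.sqrt N : ℂ) * ((Real.sqrt N : ℂ)⁻¹ *
      ∑ l, G.adjMatrix ℂ k l * ∫ y in cell σ N l, ξ y ∂μ)
    rw [mul_inv_cancel_left₀ hN]
    have hpt : ∀ y, ((graphGraphon σ G).toFun x y : ℂ) * ξ y =
        ∑ l, G.adjMatrix ℂ k l * (cell σ N l).indicator ξ y := by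
      intro y
      by_cases hy : ∃ l, y ∈ cell σ N l
      · obtain ⟨l, hl⟩ := hy
        rw [graphGraphon_of_mem σ G hk hl, Finset.sum_eq_single l]
        · rw [Set.indicator_of_mem hl, SimpleGraph.adjMatrix_apply]
          split_ifs <;> simp
        · intro l' _ hl'
          rw [Set.indicator_of_notMem (fun h : y ∈ cell σ N l' => hl' (interval_injective h hl)), mul_zero]
        · simp
      · push Not at hy
        rw [graphGraphon_of_notMem σ G (Or.inr hy)]
        simp [hy]
    unfold Graphon.opFun
    simp_rw [hpt]
    rw [integral_finsetSum _ fun l _ =>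
      (hξ.indicator₀ (nullMeasurableSet_cell σ N l)).const_mul _]
    refine Finset.sum_congr rfl fun l _ => ?_
    rw [integral_const_mul, integral_indicator₀ (nullMeasurableSet_cell σ N l)]
  · push Not at hx
    rw [signalFun_of_notMem σ _ hx]
    unfold Graphon.opFun
    simp_rw [graphGraphon_of_notMem σ G (Or.inl hx)]
    simp

variable [IsProbabilityMeasure μ]

theorem integrable_indicator_cell (σ : IsoModZero μ) {N : ℕ} (k : Fin N) (c : ℂ) :
    Integrable ((cell σ N k).indicator fun _ => c) μ :=
  (integrable_const c).indicator₀ (nullMeasurableSet_cell σ N k)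

/-- The two factors `√N` compensate the measure `1 / N` of a cell. -/
theorem inner_signalLp (σ : IsoModZero μ) {N : ℕ} (f g : EuclideanSpace ℂ (Fin N)) :
    inner ℂ (signalLp σ f) (signalLp σ g) = inner ℂ f g := by
  have h1 : inner ℂ (signalLp σ f) (signalLp σ g) =
      ∫ x, ∑ k, (cell σ N k).indicator (fun _ => (N : ℂ) * (g k * (starRingEnd ℂ) (f k))) x ∂μ := by
    rw [L2.inner_def]
    refine integral_congr_ae ?_
    filter_upwards [(memLp_signalFun σ f).coeFn_toLp, (memLp_signalFun σ g).coeFn_toLp] with x hf hg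
    have hf' : signalLp σ f x = signalFun σ f x := hf
    have hg' : signalLp σ g x = signalFun σ g x := hg
    rw [hf', hg', RCLike.inner_apply]
    by_cases hx : ∃ k, x ∈ cell σ N k
    · obtain ⟨k, hk⟩ := hx
      rw [signalFun_of_mem σ f hk, signalFun_of_mem σ g hk, Finset.sum_eq_single k]
      · rw [Set.indicator_of_mem hk, map_mul, Complex.conj_ofReal]
        have hsq : (Real.sqrt N : ℂ) * (Real.sqrt N : ℂ) = N := by
          rw [← Complex.ofReal_mul, Real.mul_self_sqrt (Nat.cast_nonneg N)]
          simp
        rw [← hsq]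
        ring
      · intro l _ hl
        exact Set.indicator_of_notMem (fun h : x ∈ cell σ N l => hl (interval_injective h hk)) _
      · simp
    · push Not at hx
      rw [signalFun_of_notMem σ f hx, signalFun_of_notMem σ g hx]
      simp [hx]
  rw [h1, integral_finsetSum _ fun k _ => integrable_indicator_cell σ k _, PiLp.inner_apply]
  refine Finset.sum_congr rfl fun k _ => ?_
  have hN : (N : ℂ) ≠ 0 := by exact_mod_cast k.pos.ne'
  rw [integral_indicator_cell, RCLike.inner_apply]
  field_simp

theorem graphFourier_eq_inner {N : ℕ} (f φ : EuclideanSpace ℂ (Fin N)) :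
    graphFourier f φ = inner ℂ φ f := by
  rw [graphFourier, PiLp.inner_apply]
  rfl

/-- The isometric embedding `f ↦ f^X` of the space of graph signals into `L²(X)`. -/
noncomputable def signalIsometry (σ : IsoModZero μ) (N : ℕ) :
    EuclideanSpace ℂ (Fin N) →ₗᵢ[ℂ] Lp ℂ 2 μ :=
  LinearMap.isometryOfInner
    { toFun := signalLp σ
      map_add' := fun f g => by
        rw [signalLp, signalLp, signalLp, ← MemLp.toLp_add]
        congr 1
        funext x
        simp only [signalFun, Pi.add_apply, ← Finset.sum_add_distrib]
        refine Finset.sum_congr rfl fun k _ => ?_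
        split_ifs <;> simp [mul_add]
      map_smul' := fun c f => by
        rw [signalLp, signalLp, RingHom.id_apply, ← MemLp.toLp_const_smul]
        congr 1
        funext x
        simp only [signalFun, Pi.smul_apply, Finset.smul_sum]
        refine Finset.sum_congr rfl fun k _ => ?_
        split_ifs
        · simp only [PiLp.smul_apply, smul_eq_mul]
          ring
        · simp }
    (inner_signalLp σ)

theorem signalIsometry_apply (σ : IsoModZero μ) {N : ℕ} (f : EuclideanSpace ℂ (Fin N)) :
    signalIsometry σ N f = signalLp σ f := rfl

theorem op_graphGraphon (σ : IsoModZero μ) {N : ℕ} (G : SimpleGraph (Fin N)) (ξ : Lp ℂ 2 μ) :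
    (graphGraphon σ G).op ξ = signalIsometry σ N (cellAverage σ G ξ) := by
  refine (MemLp.toLp_eq_toLp_iff (Graphon.memLp_opFun _ ξ) (memLp_signalFun σ _)).2 (Eventually.of_forall fun x => ?_)
  exact opFun_graphGraphon σ G ((Lp.memLp ξ).integrable (by norm_num)) x

theorem cellAverage_signalLp (σ : IsoModZero μ) {N : ℕ} (G : SimpleGraph (Fin N))
    (f : EuclideanSpace ℂ (Fin N)) :
    cellAverage σ G (signalLp σ f) = (1 / N : ℂ) • adjOp G f := by
  classical
  ext k
  have hN : (Real.sqrt N : ℂ) ≠ 0 :=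
    Complex.ofReal_ne_zero.2 (Real.sqrt_pos.2 (by exact_mod_cast k.pos)).ne'
  have hint : ∀ l, ∫ y in cell σ N l, signalLp σ f y ∂μ = (1 / N : ℂ) * ((Real.sqrt N : ℂ) * f l) :=
    fun l => by
      rw [← integral_indicator_cell σ l, ← integral_indicator₀ (nullMeasurableSet_cell σ N l)]
      refine integral_congr_ae ?_
      filter_upwards [(memLp_signalFun σ f).coeFn_toLp] with y hy
      by_cases hl : y ∈ cell σ N l
      · rw [Set.indicator_of_mem hl, Set.indicator_of_mem hl, ← signalFun_of_mem σ f hl]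
        exact hy
      · rw [Set.indicator_of_notMem hl, Set.indicator_of_notMem hl]
  have hadj : adjOp G f k = ∑ l, G.adjMatrix ℂ k l * f l := by
    rw [adjOp, Matrix.toEuclideanLin]
    simp [Matrix.mulVec, dotProduct]
  rw [PiLp.smul_apply, hadj, smul_eq_mul, Finset.mul_sum]
  show (Real.sqrt N : ℂ)⁻¹ * ∑ l, _ * ∫ y in cell σ N l, signalLp σ f y ∂μ = _
  rw [Finset.mul_sum]
  refine Finset.sum_congr rfl fun l _ => ?_
  rw [hint]
  field_simp

theorem exists_op_signalIsometry_eq (σ : IsoModZero μ) {N : ℕ} (G : SimpleGraph (Fin N)) :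
    ∃ r : ℝ, 0 < r ∧ ∀ f, (graphGraphon σ G).op (signalIsometry σ N f) =
      (r : ℂ) • signalIsometry σ N (adjOp G f) := by
  rcases N.eq_zero_or_pos with rfl | hN
  -- For `N = 0` the quotient `1 / N` is `0` in Lean; the signal space is trivial, so any positive
  -- factor works.
  · refine ⟨1, one_pos, fun f => ?_⟩
    rw [Subsingleton.elim (adjOp G f) 0, Subsingleton.elim f 0]
    simp
  · refine ⟨1 / N, by positivity, fun f => ?_⟩
    rw [op_graphGraphon, signalIsometry_apply σ f, cellAverage_signalLp, map_smul]
    push_cast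
    rfl

theorem isCompactOperator_op_graphGraphon (σ : IsoModZero μ) {N : ℕ} (G : SimpleGraph (Fin N)) :
    IsCompactOperator (graphGraphon σ G).op := by
  have hrange : ∀ ξ, (graphGraphon σ G).op ξ ∈ LinearMap.range (signalIsometry σ N).toLinearMap :=
    fun ξ => ⟨_, (op_graphGraphon σ G ξ).symm⟩
  have : FiniteDimensional ℂ (LinearMap.range (signalIsometry σ N).toLinearMap) := inferInstance
  have : ProperSpace (LinearMap.range (signalIsometry σ N).toLinearMap) :=
    FiniteDimensional.proper_rclike ℂ _
  have h : IsCompactOperator ((graphGraphon σ G).op.codRestrict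
      (LinearMap.range (signalIsometry σ N).toLinearMap) hrange) :=
    isCompactOperator_of_locallyCompactSpace_dom _
  exact h.clm_comp (Submodule.subtypeL _)

theorem recombine_eq_partialExpansion (σ : IsoModZero μ) {N : ℕ} (G : SimpleGraph (Fin N))
    (φ : ℤ → EuclideanSpace ℂ (Fin N)) (f : EuclideanSpace ℂ (Fin N)) (I : Set ℤ) :
    recombine σ G φ f I = partialExpansion ((graphGraphon σ G).op : Module.End ℂ (Lp ℂ 2 μ))
      (fun i => signalIsometry σ N (φ i)) (signalLp σ f) I := by
  obtain ⟨r, hr, hV⟩ := exists_op_signalIsometry_eq σ G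
  rw [recombine, partialExpansion, indexSet_eq_of_isometry (V := signalIsometry σ N) (A := adjOp G)
    (fun ξ => ⟨_, (op_graphGraphon σ G ξ).symm⟩) hV hr]
  simp_rw [signalIsometry_apply, inner_signalLp, graphFourier_eq_inner]

end SignalIsometry

end GraphonSignal

/-! ### Proof of the main theorem -/

open GraphonSignal

theorem corollary3p8 {X : Type*} [MeasurableSpace X] {μ : MeasureTheory.Measure X}
    [MeasureTheory.IsProbabilityMeasure μ] (σ : GraphonSignal.IsoModZero μ)
    (w : GraphonSignal.Graphon μ) (f : Lp ℂ 2 μ)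
    (N : ℕ → ℕ) (G : ∀ n, SimpleGraph (Fin (N n))) (f' : ∀ n, EuclideanSpace ℂ (Fin (N n)))
    (hconv : GraphonSignal.ConvergesInNorm
      (fun n => GraphonSignal.graphGraphon σ (G n)) (fun n => GraphonSignal.signalLp σ (f' n)) w f)
    (φ : ∀ n, ℤ → EuclideanSpace ℂ (Fin (N n)))
    (hφ : ∀ n, GraphonSignal.IsOrderedEigenbasis (GraphonSignal.adjOp (G n)) (φ n)) :
    (∀ c : ℝ, c ≠ 0 → Module.End.HasEigenvalue (w.op : Module.End ℂ (Lp ℂ 2 μ)) (c : ℂ) →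
      Tendsto
        (fun n => GraphonSignal.recombine σ (G n) (φ n) (f' n)
          (GraphonSignal.eigenIndices (w.op : Module.End ℂ (Lp ℂ 2 μ)) c))
        atTop (𝓝 (GraphonSignal.graphonFourier w f c))) ∧
    (GraphonSignal.graphonFourier w f 0 = 0 →
      (∀ n, Summable
        (fun c : {c : ℝ // c ≠ 0 ∧
            Module.End.HasEigenvalue (w.op : Module.End ℂ (Lp ℂ 2 μ)) (c : ℂ)} =>
          ‖GraphonSignal.recombine σ (G n) (φ n) (f' n)
            (GraphonSignal.eigenIndices (w.op : Module.End ℂ (Lp ℂ 2 μ)) c)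
            - GraphonSignal.graphonFourier w f c‖ ^ 2)) ∧
      Tendsto
        (fun n => ∑' c : {c : ℝ // c ≠ 0 ∧
            Module.End.HasEigenvalue (w.op : Module.End ℂ (Lp ℂ 2 μ)) (c : ℂ)},
          ‖GraphonSignal.recombine σ (G n) (φ n) (f' n)
            (GraphonSignal.eigenIndices (w.op : Module.End ℂ (Lp ℂ 2 μ)) c)
            - GraphonSignal.graphonFourier w f c‖ ^ 2)
        atTop (𝓝 0)) := by
  have hT' := tendsto_op_of_tendsto_cutNorm hconv.1
  have hs' := fun n => (graphGraphon σ (G n)).isSymmetric_op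
  have hc' := fun n => isCompactOperator_op_graphGraphon σ (G n)
  have hs := w.isSymmetric_op
  -- Compactness is inherited from the finite-rank operators of the graphs by norm convergence.
  have hc : IsCompactOperator w.op := isCompactOperator_of_tendsto hT' (Eventually.of_forall hc')
  have hg : Tendsto (fun n => signalLp σ (f' n)) atTop (𝓝 f) :=
    tendsto_iff_norm_sub_tendsto_zero.2 hconv.2
  have hψ : ∀ n, IsOrderedEigenbasis ((graphGraphon σ (G n)).op : Module.End ℂ (Lp ℂ 2 μ))
      fun i => signalIsometry σ (N n) (φ n i) := fun n => by
    obtain ⟨r, hr, hV⟩ := exists_op_signalIsometry_eq σ (G n)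
    exact (hφ n).map_isometry (fun ξ => ⟨_, (op_graphGraphon σ (G n) ξ).symm⟩) hV hr
  have hlim : ∀ c : ℝ, c ≠ 0 → Tendsto (fun n => partialExpansion
      ((graphGraphon σ (G n)).op : Module.End ℂ (Lp ℂ 2 μ))
      (fun i => signalIsometry σ (N n) (φ n i)) (signalLp σ (f' n))
      (eigenIndices (w.op : Module.End ℂ (Lp ℂ 2 μ)) c)) atTop (𝓝 (graphonFourier w f c)) :=
    fun c hc0 => tendsto_partialExpansion hs hc hs' hc' hT' hψ hg hc0
  simp_rw [recombine_eq_partialExpansion]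
  refine ⟨fun c hc0 _ => hlim c hc0, fun h0 => ?_⟩
  have hsum := hasSum_norm_sq_eigenProj_of_kernel_proj_eq_zero hs hc h0
  have hbessel := fun n => sum_norm_sq_partialExpansion_eigenIndices_le hs hc (hψ n)
    (signalLp σ (f' n))
    (p := fun c => Module.End.HasEigenvalue (w.op : Module.End ℂ (Lp ℂ 2 μ)) (c : ℂ))
  -- The Bessel bounds `‖signalLp σ (f' n)‖ ^ 2` converge to `‖f‖ ^ 2`, the full mass of the limit
  -- family.
  exact ⟨fun n => summable_norm_sub_sq (hbessel n) hsum,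
    tendsto_tsum_norm_sub_sq hbessel hsum (hg.norm.pow 2) fun c => hlim c c.2.1⟩
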